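/- Let $r\ge 1$ be a fixed integer. For a prime $p$, a power $q=p^n$ ($n\ge 1$) and a polynomial $f\in\mathbb F_q[x]$ let $C_f$ be the normalisation of the projective closure of the affine curve $y^p-y=f(x)$ over $\mathbb F_q$, and put $N(f)=(\#C_f(\mathbb F_{q^r})-1)/p$. Let $p,d$ both tend to infinity (that is, let $p=p(m)$ be primes, $n=n(m)\ge 1$ and $d=d(m)$ integers with $p(m)\to\infty$ and $d(m)\to\infty$ as $m\to\infty$), and assume that $n>1$ (for all $m$; $n$ is not necessarily constant) or that $r>1$. Let $f$ be chosen uniformly at random from the set of all monic polynomials of degree $d$ in $\mathbb F_q[x]$. Then $$p^{1/2}\,r^{-1/2}\,q^{-r/2}\left(N(f)-\frac{q^r}{p}\right)$$ converges in distribution to the Gaussian distribution with mean $0$ and variance $1$. -/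

import Mathlib

open Polynomial MeasureTheory ProbabilityTheory Filter

noncomputable section

/-- The ring of rational functions of the curve `y ^ p - y = f(x)` over the field `F`, that is
`F(x)[y] / (y ^ p - y - f(x))`. It is the total ring of fractions of the affine coordinate ring
`F[x, y] / (y ^ p - y - f(x))`, and a field when the curve is irreducible. -/
abbrev ASFunctionRing (F : Type*) [Field F] (p : ℕ) (f : F[X]) : Type _ :=
  AdjoinRoot (X ^ p - X - C (algebraMap F[X] (RatFunc F) f) : (RatFunc F)[X])

/-- The rational function `x`. -/
def asX (F : Type*) [Field F] (p : ℕ) (f : F[X]) : ASFunctionRing F p f :=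
  algebraMap (RatFunc F) (ASFunctionRing F p f) RatFunc.X

/-- The rational function `1 / x`. -/
def asInvX (F : Type*) [Field F] (p : ℕ) (f : F[X]) : ASFunctionRing F p f :=
  algebraMap (RatFunc F) (ASFunctionRing F p f) (RatFunc.X)⁻¹

/-- The integral closure of `F[a]` in the `F`-algebra `K`, as an `F`-subalgebra of `K`. -/
def normalChart (F : Type*) [Field F] {K : Type*} [CommRing K] [Algebra F K] (a : K) :
    Subalgebra F K :=
  (integralClosure (Algebra.adjoin F {a}) K).restrictScalars F

theorem self_mem_normalChart (F : Type*) [Field F] {K : Type*} [CommRing K] [Algebra F K] (a : K) :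
    a ∈ normalChart F a := by
  have h : IsIntegral (Algebra.adjoin F {a}) (algebraMap (Algebra.adjoin F {a}) K
      ⟨a, Algebra.self_mem_adjoin_singleton F a⟩) := isIntegral_algebraMap
  exact h

/-- The `L`-rational points, for a field extension `L` of `F`, of the curve `C_f`: the normalisation
of the projective closure of the affine curve `y ^ p - y = f(x)` over `F`.

This is the normal projective curve over `F` whose ring of rational functions is
`K = ASFunctionRing F p f`; the function `x` makes it a finite cover of the projective line, so it
is glued from the spectra of the integral closures in `K` of `F[x]` (the part over the affine line)
and of `F[1/x]` (the part over the complement of `x = 0`). An `L`-rational point is thus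
either an `L`-point of the first chart, or an `L`-point of the second chart that is not already
in the first one, i.e. at which `1/x` vanishes (a point over `x = ∞`). -/
def ASCurvePoints (F : Type*) [Field F] (p : ℕ) (f : F[X]) (L : Type*) [Field L] [Algebra F L] :
    Type _ :=
  (normalChart F (asX F p f) →ₐ[F] L) ⊕
    {φ : normalChart F (asInvX F p f) →ₐ[F] L //
      φ ⟨asInvX F p f, self_mem_normalChart F (asInvX F p f)⟩ = 0}

/-- `N(f) = (#C_f(L) - 1) / p`. -/
def asN (F : Type*) [Field F] (p : ℕ) (L : Type*) [Field L] [Algebra F L] (f : F[X]) : ℝ :=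
  ((Nat.card (ASCurvePoints F p f L) : ℝ) - 1) / p

/-- The set of all monic polynomials of degree `d` over `F`. -/
def MonicOfDegree (F : Type*) [Field F] (d : ℕ) : Type _ :=
  {f : F[X] // f.Monic ∧ f.natDegree = d}

instance (F : Type*) [Field F] (d : ℕ) : Nonempty (MonicOfDegree F d) :=
  ⟨⟨X ^ d, monic_X_pow d, natDegree_X_pow d⟩⟩

instance (F : Type*) [Field F] [Finite F] (d : ℕ) : Finite (MonicOfDegree F d) := by
  refine Finite.of_injective
    (fun (f : MonicOfDegree F d) (i : Fin (d + 1)) => f.1.coeff (i : ℕ)) ?_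
  intro f g h
  apply Subtype.ext
  ext i
  by_cases hi : i < d + 1
  · exact congrFun h ⟨i, hi⟩
  · rw [coeff_eq_zero_of_natDegree_lt (by have := f.2.2; omega),
      coeff_eq_zero_of_natDegree_lt (by have := g.2.2; omega)]

/-- All subsets of the finite set of monic polynomials of degree `d` are measurable. -/
instance (F : Type*) [Field F] (d : ℕ) : MeasurableSpace (MonicOfDegree F d) := ⊤

instance (F : Type*) [Field F] (d : ℕ) : DiscreteMeasurableSpace (MonicOfDegree F d) :=
  ⟨fun _ => trivial⟩

/-- The uniform probability measure on the monic polynomials of degree `d` over `F`. -/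
def uniformMonic (F : Type*) [Field F] (d : ℕ) : Measure (MonicOfDegree F d) :=
  uniformOn Set.univ

instance (F : Type*) [Field F] [Finite F] (d : ℕ) : IsProbabilityMeasure (uniformMonic F d) :=
  isProbabilityMeasure_uniformOn Set.finite_univ Set.univ_nonempty

end

/-! Write `q` for the cardinality of `F` and `L` for its extension of degree `r`. The affine curve
is étale over the line, hence normal, and by additive Hilbert 90 its fibre over `a ∈ L` has `p`
points if the absolute trace of `f(a)` vanishes and none otherwise. At infinity there are at most
`p` points. So `N(f)` differs by at most 1 from the number of `a ∈ L` at which the trace of `f(a)`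
is zero (`abs_asN_sub_sum_traceIndicator_le`).

The trace of `f(a)` depends only on the conjugacy class of `a` over `F`. The elements of degree `r`
thus contribute `r` times a sum over about `q^r / r` representatives. Interpolation shows that, when
`p ∤ r`, any `d / r` of these indicators are independent with success probability `1 / p`
(`integral_prod_traceIndicator`). The at most `r q^(r-1)` elements of smaller degree are negligible
by a second moment bound (`integral_sq_sum_traceIndicator_le`).

It remains to prove a central limit theorem for Bernoulli variables of which any `k` are
independent, with `k → ∞` (`tendsto_integral_cexp_of_prod_eq`). Moments up to order `k` agree with
those of truly independent coins. The Taylor remainders of the characteristic functions are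
controlled by a common even moment, hence by exponential moments of the coins, and for the coins the
characteristic function is computed directly. -/

/-! ### The Artin-Schreier algebra and its translation -/

section ArtinSchreierPolynomial

variable {R : Type*} [CommRing R]

theorem artinSchreier_monic {p : ℕ} (hp : 1 < p) (c : R) :
    (X ^ p - X - C c : R[X]).Monic := by
  nontriviality R
  rw [sub_sub]
  exact monic_X_pow_sub (by rw [degree_X_add_C]; exact_mod_cast hp)

theorem artinSchreier_natDegree [Nontrivial R] {p : ℕ} (hp : 1 < p) (c : R) :
    (X ^ p - X - C c : R[X]).natDegree = p := by
  rw [sub_sub, natDegree_sub_eq_left_of_natDegree_lt, natDegree_X_pow]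
  rw [natDegree_X_add_C, natDegree_X_pow]; exact hp

/-- The translation `y ↦ y + 1` of the Artin-Schreier algebra `R[y] / (y ^ p - y - c)`. -/
noncomputable def artinSchreierShift (p : ℕ) [Fact p.Prime] [CharP R p] (c : R) :
    AdjoinRoot (X ^ p - X - C c : R[X]) →ₐ[R] AdjoinRoot (X ^ p - X - C c : R[X]) :=
  AdjoinRoot.liftAlgHom _ (Algebra.ofId R _) (AdjoinRoot.root _ + 1) (by
    have h : eval₂ (AdjoinRoot.of (X ^ p - X - C c : R[X])) (AdjoinRoot.root _)
      (X ^ p - X - C c : R[X]) = 0 := AdjoinRoot.eval₂_root _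
    have e : AdjoinRoot.mk (X ^ p - X - C c : R[X]) (((X : R[X]) + 1) ^ p) =
        AdjoinRoot.mk _ (X ^ p + 1) := by rw [add_pow_char, one_pow]
    simp only [map_pow, map_add, AdjoinRoot.mk_X, map_one] at e
    simp only [eval₂_sub, eval₂_pow, eval₂_X, eval₂_C] at h ⊢
    rw [e]
    rw [← h]
    change _ - _ - AdjoinRoot.of _ _ = _
    ring)

theorem artinSchreierShift_mk (p : ℕ) [Fact p.Prime] [CharP R p] (c : R) (P : R[X]) :
    artinSchreierShift p c (AdjoinRoot.mk _ P) = AdjoinRoot.mk _ (taylor 1 P) := by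
  rw [artinSchreierShift, AdjoinRoot.liftAlgHom_mk, taylor_apply]
  change aeval _ P = _
  rw [← AdjoinRoot.aeval_eq, aeval_comp]
  simp [AdjoinRoot.aeval_eq]

theorem coeff_taylor_one_of_natDegree_le {P : R[X]} {k : ℕ} (hP : P.natDegree ≤ k + 1) :
    (taylor 1 P).coeff k = P.coeff k + (k + 1) * P.coeff (k + 1) := by
  rw [taylor_coeff, hasseDeriv_apply, sum_over_range' _ (by simp) (k + 2) (by omega),
    eval_finsetSum, Finset.sum_range_succ, Finset.sum_range_succ, Finset.sum_eq_zero]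
  · simp
  · intro i hi
    rw [Nat.choose_eq_zero_of_lt (Finset.mem_range.1 hi)]
    simp

end ArtinSchreierPolynomial

/-! ### Normality of the affine curve -/

section AffineChart

variable (F : Type*) [Field F] (p : ℕ) (f : F[X])

theorem algebraMap_asX (P : F[X]) :
    algebraMap F[X] (ASFunctionRing F p f) P = aeval (asX F p f) P := by
  rw [IsScalarTower.algebraMap_apply F[X] (RatFunc F), asX, aeval_algebraMap_apply]
  congr 1
  rw [← RatFunc.algebraMap_X, aeval_algebraMap_apply, aeval_X_left_apply]

theorem mem_normalChart_asX_iff (z : ASFunctionRing F p f) :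
    z ∈ normalChart F (asX F p f) ↔ IsIntegral F[X] z := by
  set S := Algebra.adjoin F {asX F p f}
  have hmem : ∀ P : F[X], algebraMap F[X] (ASFunctionRing F p f) P ∈ S := fun P => by
    rw [algebraMap_asX]; exact aeval_mem_adjoin_singleton F _
  let φ : F[X] →+* S := (algebraMap F[X] (ASFunctionRing F p f)).codRestrict S.toSubring hmem
  let : Algebra F[X] S := φ.toAlgebra
  have : IsScalarTower F[X] S (ASFunctionRing F p f) := IsScalarTower.of_algebraMap_eq fun _ => rfl
  have hφ : Function.Surjective (algebraMap F[X] S) := by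
    rintro ⟨y, hy⟩
    have hy' : y ∈ Algebra.adjoin F {asX F p f} := hy
    rw [Algebra.adjoin_singleton_eq_range_aeval] at hy'
    obtain ⟨P, rfl⟩ := hy'
    exact ⟨P, Subtype.ext (algebraMap_asX F p f P)⟩
  have : Algebra.IsIntegral F[X] S := ⟨fun y => by
    obtain ⟨P, rfl⟩ := hφ y
    exact isIntegral_algebraMap⟩
  change IsIntegral S z ↔ _
  exact ⟨fun h => isIntegral_trans z h, fun h => h.tower_top⟩

/-- The coordinate ring `F[x, y] / (y ^ p - y - f(x))` of the affine curve, mapped to the ring of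
rational functions. -/
noncomputable def asCoordinateHom :
    AdjoinRoot (X ^ p - X - C f : F[X][X]) →ₐ[F] ASFunctionRing F p f :=
  AdjoinRoot.liftAlgHom _ (IsScalarTower.toAlgHom F F[X] _) (AdjoinRoot.root _) (by
    have h := AdjoinRoot.eval₂_root
      (X ^ p - X - C (algebraMap F[X] (RatFunc F) f) : (RatFunc F)[X])
    simp only [eval₂_sub, eval₂_pow, eval₂_X, eval₂_C] at h ⊢
    exact h)

theorem asCoordinateHom_mk (P : F[X][X]) :
    asCoordinateHom F p f (AdjoinRoot.mk _ P) =
      AdjoinRoot.mk _ (P.map (algebraMap F[X] (RatFunc F))) := by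
  rw [asCoordinateHom, AdjoinRoot.liftAlgHom_mk, ← AdjoinRoot.aeval_eq, aeval_def, eval₂_map]
  rfl

variable [Fact p.Prime]

/-- Divisibility by a monic polynomial descends from `F(x)[y]` to `F[x][y]`. -/
theorem asCoordinateHom_injective : Function.Injective (asCoordinateHom F p f) := by
  have hp1 : 1 < p := (Fact.out : p.Prime).one_lt
  rw [injective_iff_map_eq_zero]
  intro z hz
  obtain ⟨P, rfl⟩ := AdjoinRoot.mk_surjective z
  rw [asCoordinateHom_mk, AdjoinRoot.mk_eq_zero] at hz
  rw [AdjoinRoot.mk_eq_zero]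
  refine (map_dvd_map (algebraMap F[X] (RatFunc F)) (IsFractionRing.injective _ _)
    (artinSchreier_monic hp1 f)).1 ?_
  simpa using hz

variable [CharP F p]

/-- Normality by finite differences, with no irreducibility of `y ^ p - y - f` needed. If `P(y)` is
integral, so is `P(y + 1) - P(y)`, which has lower degree and has `(k + 1) c` as coefficient of `y ^
k`, where `c` is the coefficient of `y ^ (k + 1)` in `P`. By induction this lies in `F[x]`, and `k +
1 < p` is invertible, so `c` is in `F[x]`. Subtracting `c y ^ (k + 1)` lowers the degree again. The
base case is that `F[x]` is integrally closed. -/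
theorem coeff_mem_range_of_isIntegral {k : ℕ} (hk : k < p) (P : (RatFunc F)[X])
    (hP : P.natDegree ≤ k)
    (hint : IsIntegral F[X] (AdjoinRoot.mk _ P : ASFunctionRing F p f)) :
    P ∈ lifts (algebraMap F[X] (RatFunc F)) := by
  have hp1 : 1 < p := (Fact.out : p.Prime).one_lt
  have : CharP (RatFunc F) p := charP_of_injective_algebraMap
    (algebraMap F (RatFunc F)).injective p
  have hdeg : (X ^ p - X - C (algebraMap F[X] (RatFunc F) f) : (RatFunc F)[X]).degree ≠ 0 := by
    rw [degree_eq_natDegree (artinSchreier_monic hp1 _).ne_zero, artinSchreier_natDegree hp1]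
    exact_mod_cast (by omega : p ≠ 0)
  have hC : ∀ c : RatFunc F, IsIntegral F[X] (AdjoinRoot.mk _ (C c) : ASFunctionRing F p f) →
      c ∈ (algebraMap F[X] (RatFunc F)).range := fun c hc => by
    rw [AdjoinRoot.mk_C] at hc
    have h1 : IsIntegral F[X] c := (isIntegral_algebraMap_iff
      (AdjoinRoot.of.injective_of_degree_ne_zero hdeg)).1 hc
    exact IsIntegrallyClosed.isIntegral_iff.1 h1
  induction k generalizing P with
  | zero =>
    rw [eq_C_of_natDegree_le_zero hP] at hint ⊢
    obtain ⟨y, hy⟩ := hC _ hint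
    rw [← hy]
    exact C_mem_lifts _ y
  | succ k ih =>
    have hsub : IsIntegral F[X] (AdjoinRoot.mk _ (taylor 1 P - P) : ASFunctionRing F p f) := by
      rw [map_sub, ← artinSchreierShift_mk]
      exact (hint.map ((artinSchreierShift p _).restrictScalars F[X])).sub hint
    have hcoeff : (taylor 1 P - P).coeff k = (k + 1 : RatFunc F) * P.coeff (k + 1) := by
      rw [coeff_sub, coeff_taylor_one_of_natDegree_le hP]; ring
    have hdeg' : (taylor 1 P - P).natDegree ≤ k := by
      rw [natDegree_le_iff_coeff_eq_zero]
      intro N hN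
      obtain h | h := (Nat.succ_le_of_lt hN).lt_or_eq
      · rw [coeff_eq_zero_of_natDegree_lt]
        refine lt_of_le_of_lt (natDegree_sub_le _ _) ?_
        rw [natDegree_taylor]
        simp; omega
      · rw [← h, coeff_sub, coeff_taylor_one_of_natDegree_le (by omega),
          coeff_eq_zero_of_natDegree_lt (n := k.succ + 1) (by omega)]
        simp
    have h1 := ih (by omega) _ hdeg' hsub
    have hne : ((k + 1 : ℕ) : F) ≠ 0 := fun h0 => by
      have := Nat.le_of_dvd (by omega) ((CharP.cast_eq_zero_iff F p _).1 h0)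
      omega
    obtain ⟨y, hy⟩ : P.coeff (k + 1) ∈ (algebraMap F[X] (RatFunc F)).range := by
      obtain ⟨w, hw⟩ := (lifts_iff_coeff_lifts _).1 h1 k
      refine ⟨C (((k + 1 : ℕ) : F)⁻¹) * w, ?_⟩
      rw [map_mul, hw, hcoeff, ← mul_assoc]
      have : (k + 1 : RatFunc F) = algebraMap F[X] (RatFunc F) (C ((k + 1 : ℕ) : F)) := by simp
      rw [this, ← map_mul, ← C_mul, inv_mul_cancel₀ hne]
      simp
    have hy' : AdjoinRoot.mk (X ^ p - X - C (algebraMap F[X] (RatFunc F) f) : (RatFunc F)[X])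
        (C (P.coeff (k + 1)) * X ^ (k + 1)) = (algebraMap F[X] (ASFunctionRing F p f) y) *
          (AdjoinRoot.root _) ^ (k + 1) := by
      rw [← hy, map_mul, map_pow, AdjoinRoot.mk_C, AdjoinRoot.mk_X]; rfl
    have hroot : IsIntegral F[X] (AdjoinRoot.root _ : ASFunctionRing F p f) := by
      refine ⟨X ^ p - X - C f, artinSchreier_monic hp1 _, ?_⟩
      have h := AdjoinRoot.eval₂_root
        (X ^ p - X - C (algebraMap F[X] (RatFunc F) f) : (RatFunc F)[X])
      simp only [eval₂_sub, eval₂_pow, eval₂_X, eval₂_C] at h ⊢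
      exact h
    have hlead : IsIntegral F[X] (AdjoinRoot.mk _ (C (P.coeff (k + 1)) * X ^ (k + 1)) :
        ASFunctionRing F p f) := by
      rw [hy']
      exact isIntegral_algebraMap.mul (hroot.pow _)
    have h2 := ih (by omega) (P - C (P.coeff (k + 1)) * X ^ (k + 1)) (by
      rw [natDegree_le_iff_coeff_eq_zero]
      intro N hN
      rw [coeff_sub, coeff_C_mul_X_pow]
      split_ifs with h
      · rw [h, sub_self]
      · rw [coeff_eq_zero_of_natDegree_lt (by omega), sub_zero]) (by
      rw [map_sub]; exact hint.sub hlead)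
    rw [← sub_add_cancel P (C (P.coeff (k + 1)) * X ^ (k + 1))]
    refine add_mem h2 (mul_mem ?_ (pow_mem (X_mem_lifts _) _))
    rw [← hy]
    exact C_mem_lifts _ y

theorem asCoordinateHom_range :
    (asCoordinateHom F p f).range = normalChart F (asX F p f) := by
  have hp1 : 1 < p := (Fact.out : p.Prime).one_lt
  ext z
  rw [mem_normalChart_asX_iff]
  constructor
  · rintro ⟨w, rfl⟩
    have hw : IsIntegral F[X] w := by
      have := (artinSchreier_monic hp1 f).finite_adjoinRoot
      exact IsIntegral.of_finite F[X] w
    let ψ : AdjoinRoot (X ^ p - X - C f : F[X][X]) →ₐ[F[X]] ASFunctionRing F p f :=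
      { asCoordinateHom F p f with
        commutes' := fun P => by
          change asCoordinateHom F p f (AdjoinRoot.of _ P) = _
          rw [asCoordinateHom, AdjoinRoot.liftAlgHom_of]
          rfl }
    exact hw.map ψ
  · intro hz
    obtain ⟨P, rfl⟩ := AdjoinRoot.mk_surjective z
    have hmon := artinSchreier_monic hp1 (algebraMap F[X] (RatFunc F) f)
    have hmod : AdjoinRoot.mk (X ^ p - X - C (algebraMap F[X] (RatFunc F) f)) P = AdjoinRoot.mk _
        (P %ₘ (X ^ p - X - C (algebraMap F[X] (RatFunc F) f) : (RatFunc F)[X])) := by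
      rw [AdjoinRoot.mk_eq_mk]
      set g := X ^ p - X - C (algebraMap F[X] (RatFunc F) f)
      exact ⟨P /ₘ g, by linear_combination -(modByMonic_add_div P g)⟩
    rw [hmod] at hz ⊢
    obtain ⟨Q, hQ⟩ := coeff_mem_range_of_isIntegral F p f (k := p - 1) (by omega) _ (by
      have := natDegree_modByMonic_lt P hmon (fun h => by
        have := artinSchreier_natDegree hp1 (algebraMap F[X] (RatFunc F) f)
        rw [h, natDegree_one] at this
        omega)
      rw [artinSchreier_natDegree hp1] at this
      omega) hz
    refine ⟨AdjoinRoot.mk _ Q, ?_⟩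
    rw [← hQ]
    exact asCoordinateHom_mk F p f Q

/-- The `L`-points of the normal affine chart are the `L`-points of the affine curve. -/
noncomputable def normalChartAlgHomEquiv (L : Type*) [Field L] [Algebra F L] :
    (normalChart F (asX F p f) →ₐ[F] L) ≃ {ab : L × L // ab.2 ^ p - ab.2 = aeval ab.1 f} := by
  let e : AdjoinRoot (X ^ p - X - C f : F[X][X]) ≃ₐ[F] normalChart F (asX F p f) :=
    (AlgEquiv.ofInjective _ (asCoordinateHom_injective F p f)).trans
      (Subalgebra.equivOfEq _ _ (asCoordinateHom_range F p f))
  refine (AlgEquiv.arrowCongr e AlgEquiv.refl).symm.trans ⟨fun φ => ⟨(φ (AdjoinRoot.of _ X), φ (AdjoinRoot.root _)), ?_⟩,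
    fun ab => AdjoinRoot.liftAlgHom _ (aeval ab.1.1) ab.1.2 ?_, ?_, ?_⟩
  · have h := congrArg φ (AdjoinRoot.eval₂_root (X ^ p - X - C f : F[X][X]))
    have h2 : φ (AdjoinRoot.of _ f) = aeval (φ (AdjoinRoot.of _ X)) f := by
      have : (φ.comp (AdjoinRoot.ofAlgHom F (X ^ p - X - C f : F[X][X]))) =
          aeval (φ (AdjoinRoot.of _ X)) := by
        ext; simp
      exact DFunLike.congr_fun this f
    simp only [eval₂_sub, eval₂_pow, eval₂_X, eval₂_C, map_sub, map_pow, map_zero, h2] at h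
    exact sub_eq_zero.1 h
  · simp [ab.2]
  · intro φ
    apply AdjoinRoot.algHom_ext'
    · ext; simp
    · simp
  · rintro ⟨⟨a, b⟩, h⟩
    simp

end AffineChart

/-! ### Dimension of the fibre `t = 0` -/

section QuotientRank

variable {F : Type*} [Field F]

/-- If any `p + 1` elements of `K` are linearly dependent over `F[1 / t]`, then a subring of `K`
that contains `t` has dimension at most `p` modulo `t`. -/
theorem rank_quotient_span_singleton_le {K : Type*} [CommRing K] [Algebra F K] [Algebra F[X] K]
    (x : K) {p : ℕ} {A : Subalgebra F K} (t : A) (hxt : x * t = 1)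
    (hdvd : ∀ (N : ℕ) (P : F[X]), P.natDegree ≤ N →
      algebraMap F[X] K P = x ^ N * aeval (t : K) (reflect N P))
    (hK : ∀ (s : Finset (A ⧸ Ideal.span {t})) (a : s → K),
      LinearIndependent F[X] a → s.card ≤ p) :
    Module.rank F (A ⧸ Ideal.span {t}) ≤ p := by
  refine rank_le fun s hs => ?_
  choose a ha using fun b : A ⧸ Ideal.span {t} => Ideal.Quotient.mk_surjective b
  by_contra! hcard
  have hdep := mt (hK s fun i => (a i : K)) hcard.not_ge
  rw [Fintype.not_linearIndependent_iff] at hdep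
  obtain ⟨P, hsum, i₀, hi₀⟩ := hdep
  -- Let `N` be the largest degree in the relation. Multiplied by `t ^ N`, the relation has
  -- coefficients polynomial in `t`. Modulo `t` only their constant terms survive, which are the
  -- coefficients of degree `N` of the `P i`; that of `P j` is nonzero.
  obtain ⟨j, -, hj⟩ := Finset.exists_max_image (Finset.univ : Finset s)
    (fun i => (P i).degree) ⟨i₀, Finset.mem_univ _⟩
  have hPj : P j ≠ 0 := fun h => by
    have := hj i₀ (Finset.mem_univ _)
    rw [h, degree_zero, le_bot_iff, degree_eq_bot] at this
    exact hi₀ this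
  set N := (P j).natDegree
  have hN : ∀ i, (P i).natDegree ≤ N := fun i => natDegree_le_natDegree (hj i (Finset.mem_univ _))
  have hrel : ∑ i : s, aeval t (reflect N (P i)) * a i = 0 := by
    apply Subtype.ext
    have h0 : x ^ N * (((∑ i : s, aeval t (reflect N (P i)) * a i : A)) : K) = 0 := by
      rw [← hsum, AddSubmonoidClass.coe_finsetSum, Finset.mul_sum]
      refine Finset.sum_congr rfl fun i _ => ?_
      rw [Algebra.smul_def, hdvd N _ (hN i), MulMemClass.coe_mul, aeval_subalgebra_coe, mul_assoc]
    have h3 := congrArg (fun z => (t : K) ^ N * z) h0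
    simp only [← mul_assoc, ← mul_pow, mul_zero] at h3
    rwa [mul_comm (t : K), hxt, one_pow, one_mul] at h3
  have hrel' : ∑ i : s, (P i).coeff N • (i : A ⧸ Ideal.span {t}) = 0 := by
    have h4 := congrArg (Ideal.Quotient.mk (Ideal.span {t})) hrel
    rw [map_sum, map_zero] at h4
    rw [← h4]
    refine Finset.sum_congr rfl fun i _ => ?_
    rw [map_mul, ha]
    refine (Algebra.smul_def ((P i).coeff N) (i : A ⧸ Ideal.span {t})).trans ?_
    congr 1
    have h5 : Ideal.Quotient.mk (Ideal.span {t}) t = 0 :=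
      Ideal.Quotient.eq_zero_iff_mem.2 (Ideal.mem_span_singleton_self t)
    have h6 : Ideal.Quotient.mk (Ideal.span {t}) (aeval t (reflect N (P i))) =
        aeval (Ideal.Quotient.mk (Ideal.span {t}) t) (reflect N (P i)) :=
      (aeval_algHom_apply (Ideal.Quotient.mkₐ F (Ideal.span {t})) t _).symm
    rw [h6, h5, ← coeff_zero_eq_aeval_zero', coeff_reflect]
    simp [revAt_le]
  rw [Fintype.linearIndependent_iff] at hs
  exact hPj (leadingCoeff_eq_zero.1 (hs _ hrel' j))

theorem card_algHom_eq_zero_le {A : Type*} [CommRing A] [Algebra F A] (t : A) {p : ℕ}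
    (hrank : Module.rank F (A ⧸ Ideal.span {t}) ≤ p) (L : Type*) [Field L] [Algebra F L] :
    Finite {φ : A →ₐ[F] L // φ t = 0} ∧ Nat.card {φ : A →ₐ[F] L // φ t = 0} ≤ p := by
  have : Module.Finite F (A ⧸ Ideal.span {t}) := Module.rank_lt_aleph0_iff.1
    (hrank.trans_lt (Cardinal.natCast_lt_aleph0))
  have hfin : Module.finrank F (A ⧸ Ideal.span {t}) ≤ p := Module.finrank_le_of_rank_le hrank
  let g : {φ : A →ₐ[F] L // φ t = 0} → (A ⧸ Ideal.span {t} →ₐ[F] L) := fun φ =>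
    Ideal.Quotient.liftₐ (Ideal.span {t}) φ.1 (fun x hx => by
      obtain ⟨y, rfl⟩ := Ideal.mem_span_singleton'.1 hx
      rw [map_mul, φ.2, mul_zero])
  have hg : Function.Injective g := fun φ ψ h => by
    apply Subtype.ext
    ext x
    exact DFunLike.congr_fun h (Ideal.Quotient.mk _ x)
  exact ⟨Finite.of_injective g hg, (Nat.card_le_card_of_injective g hg).trans
    ((card_algHom_le_finrank F _ L).trans hfin)⟩

end QuotientRank

/-! ### Points at infinity -/

section InfinityChart

variable (F : Type*) [Field F] (p : ℕ) (f : F[X])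

theorem algebraMap_eq_pow_mul_aeval_asInvX {N : ℕ} {P : F[X]} (hP : P.natDegree ≤ N) :
    algebraMap F[X] (ASFunctionRing F p f) P =
      asX F p f ^ N * aeval (asInvX F p f) (reflect N P) := by
  have h1 : algebraMap F[X] (RatFunc F) P =
      RatFunc.X ^ N * aeval (RatFunc.X)⁻¹ (reflect N P) := by
    let : Invertible (RatFunc.X : RatFunc F) := invertibleOfNonzero RatFunc.X_ne_zero
    have := eval₂_reflect_mul_pow (algebraMap F (RatFunc F)) RatFunc.X N P hP
    rw [invOf_eq_inv] at this
    rw [aeval_def, mul_comm, this, ← aeval_def, ← RatFunc.algebraMap_X, aeval_algebraMap_apply,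
      aeval_X_left_apply]
  rw [IsScalarTower.algebraMap_apply F[X] (RatFunc F), h1, map_mul, map_pow, asX, asInvX,
    aeval_algebraMap_apply]

variable [Fact p.Prime]

theorem card_le_of_linearIndependent_asFunctionRing {ι : Type*} [Fintype ι]
    {a : ι → ASFunctionRing F p f} (ha : LinearIndependent F[X] a) : Fintype.card ι ≤ p := by
  have hp1 : 1 < p := (Fact.out : p.Prime).one_lt
  have hmon := artinSchreier_monic hp1 (algebraMap F[X] (RatFunc F) f)
  rw [LinearIndependent.iff_fractionRing F[X] (RatFunc F)] at ha
  have : Module.Finite (RatFunc F) (ASFunctionRing F p f) := hmon.finite_adjoinRoot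
  have h2 : Module.finrank (RatFunc F) (ASFunctionRing F p f) = p := by
    have h3 := (AdjoinRoot.powerBasis' hmon).finrank
    rw [AdjoinRoot.powerBasis'_dim, artinSchreier_natDegree hp1] at h3
    exact h3
  exact h2 ▸ ha.fintype_card_le_finrank

/-- The chart at infinity is never computed. Its fibre over `1/x = 0` has dimension at most the
degree `p` of the cover of the line, whatever `f` is. -/
theorem card_points_at_infinity_le (L : Type*) [Field L] [Algebra F L] :
    Finite {φ : normalChart F (asInvX F p f) →ₐ[F] L //
      φ ⟨asInvX F p f, self_mem_normalChart F (asInvX F p f)⟩ = 0} ∧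
    Nat.card {φ : normalChart F (asInvX F p f) →ₐ[F] L //
      φ ⟨asInvX F p f, self_mem_normalChart F (asInvX F p f)⟩ = 0} ≤ p := by
  have hxt : asX F p f * asInvX F p f = 1 := by
    rw [asX, asInvX, ← map_mul, mul_inv_cancel₀ RatFunc.X_ne_zero, map_one]
  have hrank := rank_quotient_span_singleton_le (K := ASFunctionRing F p f) (asX F p f) (p := p)
    (A := normalChart F (asInvX F p f)) ⟨asInvX F p f, self_mem_normalChart F (asInvX F p f)⟩ hxt
    (fun N P hP => algebraMap_eq_pow_mul_aeval_asInvX F p f hP)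
    (fun s a ha => by
      have := card_le_of_linearIndependent_asFunctionRing F p f ha
      rwa [Fintype.card_coe] at this)
  exact card_algHom_eq_zero_le _ hrank L

end InfinityChart

/-- With `I` points at infinity the difference is `(I - 1) / p`, where `0 ≤ I ≤ p`. -/
theorem abs_asN_sub_le (F : Type*) [Field F] (p : ℕ) [Fact p.Prime] [CharP F p]
    (L : Type*) [Field L] [Algebra F L] [Finite L] (f : F[X]) :
    |asN F p L f - (Nat.card {ab : L × L // ab.2 ^ p - ab.2 = aeval ab.1 f} : ℝ) / p| ≤ 1 := by
  obtain ⟨hfin, hle⟩ := card_points_at_infinity_le F p f L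
  have hp1 : 1 < p := (Fact.out : p.Prime).one_lt
  have hpos : (0 : ℝ) < p := by exact_mod_cast (by omega : 0 < p)
  have : Finite (normalChart F (asX F p f) →ₐ[F] L) :=
    Finite.of_equiv _ (normalChartAlgHomEquiv F p f L).symm
  rw [asN, ASCurvePoints, Nat.card_sum, Nat.card_congr (normalChartAlgHomEquiv F p f L)]
  set I := Nat.card {φ : normalChart F (asInvX F p f) →ₐ[F] L //
      φ ⟨asInvX F p f, self_mem_normalChart F (asInvX F p f)⟩ = 0}
  have h1 : (I : ℝ) ≤ p := by exact_mod_cast hle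
  have h0 : (0 : ℝ) ≤ I := by positivity
  have h2 : (1 : ℝ) < p := by exact_mod_cast hp1
  rw [← sub_div, abs_div, abs_of_pos hpos, div_le_one hpos, abs_le]
  push_cast
  constructor <;> linarith

/-! ### Additive Hilbert 90 and the count of affine points -/

section AdditiveHilbert90

variable (p : ℕ) [Fact p.Prime] (L : Type*) [Field L] [Algebra (ZMod p) L]

/-- The Artin-Schreier map `b ↦ b ^ p - b`. -/
noncomputable def artinSchreierMap : L →ₗ[ZMod p] L :=
  (FiniteField.frobeniusAlgHom (ZMod p) L).toLinearMap - LinearMap.id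

theorem artinSchreierMap_apply (b : L) : artinSchreierMap p L b = b ^ p - b := by
  simp [artinSchreierMap, ZMod.card]

theorem ker_artinSchreierMap : LinearMap.ker (artinSchreierMap p L) = Submodule.span (ZMod p) {1} := by
  have : CharP L p := charP_of_injective_algebraMap (algebraMap (ZMod p) L).injective p
  ext b
  rw [LinearMap.mem_ker, artinSchreierMap_apply, sub_eq_zero, ← Subfield.mem_bot_iff_pow_eq_self L p,
    ← ZMod.fieldRange_castHom_eq_bot p, Submodule.mem_span_singleton]
  refine exists_congr fun c => ?_
  rw [Algebra.smul_def, mul_one, RingHom.congr_fun (Subsingleton.elim (ZMod.castHom _ L) (algebraMap (ZMod p) L))]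

variable [Finite L]

theorem trace_pow_char (b : L) : Algebra.trace (ZMod p) L (b ^ p) = Algebra.trace (ZMod p) L b := by
  have h := Algebra.trace_eq_of_algEquiv
    (FiniteField.frobeniusAlgEquivOfAlgebraic (ZMod p) L) b
  rwa [FiniteField.coe_frobeniusAlgEquivOfAlgebraic, ZMod.card] at h

/-- One inclusion is the Frobenius invariance of the trace. Both spaces have codimension 1: the
Artin-Schreier map has the prime field as kernel, and the trace is onto the prime field. -/
theorem range_artinSchreierMap :
    LinearMap.range (artinSchreierMap p L) = LinearMap.ker (Algebra.trace (ZMod p) L) := by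
  refine Submodule.eq_of_le_of_finrank_eq ?_ ?_
  · rintro _ ⟨b, rfl⟩
    rw [LinearMap.mem_ker, artinSchreierMap_apply, map_sub, trace_pow_char, sub_self]
  · have h1 := (artinSchreierMap p L).finrank_range_add_finrank_ker
    have h2 := (Algebra.trace (ZMod p) L).finrank_range_add_finrank_ker
    rw [ker_artinSchreierMap, finrank_span_singleton one_ne_zero] at h1
    rw [LinearMap.range_eq_top.2 (Algebra.trace_surjective (ZMod p) L), finrank_top,
      Module.finrank_self] at h2
    omega

theorem card_artinSchreier_fiber (u : L) :
    Nat.card {b : L // b ^ p - b = u} =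
      open Classical in if Algebra.trace (ZMod p) L u = 0 then p else 0 := by
  split_ifs with h
  · obtain ⟨b₀, hb₀⟩ : u ∈ LinearMap.range (artinSchreierMap p L) := by
      rw [range_artinSchreierMap]; exact h
    let e : {b : L // b ^ p - b = u} ≃ LinearMap.ker (artinSchreierMap p L) :=
      { toFun := fun b => ⟨b.1 - b₀, by
          rw [LinearMap.mem_ker, map_sub, hb₀, artinSchreierMap_apply, b.2, sub_self]⟩
        invFun := fun b => ⟨b.1 + b₀, by
          rw [← artinSchreierMap_apply, map_add, hb₀, LinearMap.mem_ker.1 b.2, zero_add]⟩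
        left_inv := fun b => by simp
        right_inv := fun b => by simp }
    rw [Nat.card_congr e, Module.natCard_eq_pow_finrank (K := ZMod p), ker_artinSchreierMap,
      finrank_span_singleton one_ne_zero, pow_one, Nat.card_zmod]
  · rw [Nat.card_eq_zero]
    refine Or.inl ⟨fun b => h ?_⟩
    rw [← LinearMap.mem_ker, ← range_artinSchreierMap]
    exact ⟨b.1, by rw [artinSchreierMap_apply, b.2]⟩

theorem card_artinSchreier_points [Fintype L] (g : L → L) :
    Nat.card {ab : L × L // ab.2 ^ p - ab.2 = g ab.1} =
      p * ∑ a : L, open Classical in if Algebra.trace (ZMod p) L (g a) = 0 then 1 else 0 := by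
  classical
  let e : {ab : L × L // ab.2 ^ p - ab.2 = g ab.1} ≃ Σ a : L, {b : L // b ^ p - b = g a} :=
    { toFun := fun x => ⟨x.1.1, x.1.2, x.2⟩
      invFun := fun y => ⟨(y.1, y.2.1), y.2.2⟩
      left_inv := fun _ => rfl
      right_inv := fun _ => rfl }
  rw [Nat.card_congr e, Nat.card_sigma, Finset.mul_sum]
  refine Finset.sum_congr rfl fun a _ => ?_
  rw [card_artinSchreier_fiber]
  simp

end AdditiveHilbert90

/-! ### Interpolation at non-conjugate points and equidistribution of traces -/

section Interpolation

variable {F L : Type*} [Field F] [Field L] [Algebra F L] [FiniteDimensional F L]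

/-- Chinese remainder theorem: distinct minimal polynomials are coprime, so the product of the
others can be inverted modulo that of `a`. Reducing the cofactor modulo `minpoly F a` gives the
degree bound. -/
theorem exists_interpolation [DecidableEq L] {T : Finset L} (hT : Set.InjOn (minpoly F) (T : Set L)) {a : L}
    (ha : a ∈ T) (v : F) :
    ∃ f : F[X], f.degree < (∑ b ∈ T, (minpoly F b).natDegree : ℕ) ∧
      ∀ b ∈ T, aeval b f = if b = a then algebraMap F L v else 0 := by
  have hint : ∀ b : L, IsIntegral F b := fun b => Algebra.IsIntegral.isIntegral b
  set h := ∏ b ∈ T.erase a, minpoly F b with hh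
  have hcop : IsCoprime h (minpoly F a) := by
    refine IsCoprime.prod_left fun b hb => ?_
    obtain ⟨hne, hb⟩ := Finset.mem_erase.1 hb
    refine ((minpoly.irreducible (hint b)).coprime_iff_not_dvd).2 fun hdvd => hne (hT hb ha ?_)
    exact eq_of_monic_of_associated (minpoly.monic (hint b)) (minpoly.monic (hint a))
      ((minpoly.irreducible (hint b)).associated_of_dvd (minpoly.irreducible (hint a)) hdvd)
  obtain ⟨u, w, huw⟩ := hcop
  set g := (C v * u) %ₘ minpoly F a
  have hga : aeval a g * aeval a h = algebraMap F L v := by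
    have h1 : aeval a g = aeval a (C v * u) := by
      have := congrArg (aeval a) (modByMonic_add_div (C v * u) (minpoly F a))
      rw [← this, map_add, map_mul, minpoly.aeval, zero_mul, add_zero]
    have h2 := congrArg (aeval a) huw
    simp only [map_add, map_mul, minpoly.aeval, mul_zero, add_zero, map_one] at h2
    rw [h1, map_mul, aeval_C, mul_assoc, h2, mul_one]
  have hhm : h.Monic := monic_prod_of_monic _ _ fun b _ => minpoly.monic (hint b)
  refine ⟨g * h, ?_, fun b hb => ?_⟩
  · have hg : g.degree < (minpoly F a).natDegree := by
      rw [← degree_eq_natDegree (minpoly.ne_zero (hint a))]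
      exact degree_modByMonic_lt _ (minpoly.monic (hint a))
    have hhd : h.natDegree = ∑ b ∈ T.erase a, (minpoly F b).natDegree :=
      natDegree_prod_of_monic _ _ fun b _ => minpoly.monic (hint b)
    by_cases hg0 : g = 0
    · rw [hg0, zero_mul, degree_zero]
      exact WithBot.bot_lt_coe _
    rw [← Finset.add_sum_erase _ _ ha, degree_mul, degree_eq_natDegree hhm.ne_zero, hhd,
      degree_eq_natDegree hg0]
    rw [degree_eq_natDegree hg0] at hg
    norm_cast at hg ⊢
    omega
  · split_ifs with hba
    · rw [hba, map_mul, hga]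
    · have : aeval b h = 0 := by
        rw [hh, map_prod]
        exact Finset.prod_eq_zero (Finset.mem_erase.2 ⟨hba, hb⟩) (minpoly.aeval F b)
      rw [map_mul, this, mul_zero]

variable {p : ℕ} [Fact p.Prime] [Algebra (ZMod p) F] [Algebra (ZMod p) L]
  [IsScalarTower (ZMod p) F L] [Finite F]

/-- On `F` the trace of `L` is `[L : F]` times the trace of `F`, so prescribed traces can be reached
by values in `F`, which are the values interpolated here. -/
theorem exists_trace_algebraMap_eq (hp : ¬ p ∣ Module.finrank F L) (c : ZMod p) :
    ∃ v : F, Algebra.trace (ZMod p) L (algebraMap F L v) = c := by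
  have hr : ((Module.finrank F L : ℕ) : ZMod p) ≠ 0 := by
    rwa [Ne, ZMod.natCast_eq_zero_iff]
  obtain ⟨v, hv⟩ := Algebra.trace_surjective (ZMod p) F ((Module.finrank F L : ZMod p)⁻¹ * c)
  refine ⟨v, ?_⟩
  have : Module.Finite (ZMod p) L := Module.Finite.trans F L
  rw [← Algebra.trace_trace (S := F), Algebra.trace_algebraMap, map_nsmul, hv, nsmul_eq_mul,
    mul_inv_cancel_left₀ hr]

/-- The traces of the values at the points of `T`. -/
noncomputable def traceEval (p : ℕ) [Fact p.Prime] [Algebra (ZMod p) L] (T : Finset L) (d : ℕ) :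
    degreeLT F d →+ (T → ZMod p) where
  toFun f a := Algebra.trace (ZMod p) L (aeval (a : L) (f : F[X]))
  map_zero' := by ext; simp
  map_add' _ _ := by ext; simp

theorem traceEval_surjective (hp : ¬ p ∣ Module.finrank F L) {T : Finset L}
    (hT : Set.InjOn (minpoly F) (T : Set L)) {d : ℕ} (hd : ∑ b ∈ T, (minpoly F b).natDegree ≤ d) :
    Function.Surjective (traceEval (F := F) p T d) := by
  classical
  intro c
  choose v hv using fun a : T => exists_trace_algebraMap_eq (F := F) (L := L) hp (c a)
  choose f hf hfv using fun a : T => exists_interpolation hT a.2 (v a)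
  refine ⟨∑ a : T, ⟨f a, mem_degreeLT.2 ((hf a).trans_le (by exact_mod_cast hd))⟩, ?_⟩
  rw [map_sum]
  ext b
  rw [Finset.sum_apply, Finset.sum_eq_single b]
  · change Algebra.trace (ZMod p) L (aeval (b : L) (f b)) = _
    rw [hfv b b b.2, if_pos rfl, hv]
  · intro a _ hab
    change Algebra.trace (ZMod p) L (aeval (b : L) (f a)) = _
    rw [hfv a b b.2, if_neg (fun h => hab (Subtype.ext h).symm), map_zero]
  · simp

/-- Monic polynomials of degree `d` are `X ^ d` plus the group of polynomials of degree less than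
`d`, on which `traceEval` is a surjective homomorphism. Translation by a preimage `g₀` of minus the
traces of `X ^ d` carries the set counted to its kernel, of index `p ^ T.card`. -/
theorem card_monicOfDegree_trace_eq_zero (hp : ¬ p ∣ Module.finrank F L) {T : Finset L}
    (hT : Set.InjOn (minpoly F) (T : Set L)) {d : ℕ} (hd : ∑ b ∈ T, (minpoly F b).natDegree ≤ d) :
    Nat.card {f : MonicOfDegree F d // ∀ a ∈ T, Algebra.trace (ZMod p) L (aeval a f.1) = 0} *
      p ^ T.card = Nat.card (MonicOfDegree F d) := by
  classical
  have hsurj := traceEval_surjective (F := F) hp hT hd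
  let e : MonicOfDegree F d ≃ degreeLT F d := monicEquivDegreeLT d
  have he : ∀ f : MonicOfDegree F d, f.1 = X ^ d + (e f : F[X]) := fun f => by
    exact congrArg Subtype.val (e.symm_apply_apply f).symm
  have : Finite (degreeLT F d) := Finite.of_equiv _ e
  obtain ⟨g₀, hg₀⟩ := hsurj fun a => - Algebra.trace (ZMod p) L (aeval (a : L) (X ^ d : F[X]))
  let e' : {f : MonicOfDegree F d // ∀ a ∈ T, Algebra.trace (ZMod p) L (aeval a f.1) = 0} ≃
      (traceEval (F := F) p T d).ker :=
    (e.trans (Equiv.subRight g₀)).subtypeEquiv fun f => by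
      rw [AddMonoidHom.mem_ker, Equiv.trans_apply, Equiv.subRight_apply, map_sub, hg₀]
      rw [sub_eq_zero, funext_iff, Subtype.forall]
      refine forall₂_congr fun a ha => ?_
      rw [he f, map_add, map_add, add_comm, add_eq_zero_iff_eq_neg]
      rfl
  have hq : Nat.card (degreeLT F d) = Nat.card (degreeLT F d ⧸ (traceEval (F := F) p T d).ker) *
      Nat.card (traceEval (F := F) p T d).ker :=
    AddSubgroup.card_eq_card_quotient_mul_card_addSubgroup _
  rw [Nat.card_congr e', Nat.card_congr e, hq,
    Nat.card_congr (QuotientAddGroup.quotientKerEquivOfSurjective _ hsurj).toEquiv,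
    Nat.card_fun, Nat.card_zmod, Nat.card_eq_fintype_card (α := T), Fintype.card_coe, mul_comm]

end Interpolation

/-! ### Taylor remainder of the exponential on the imaginary axis -/

section ExponentialRemainder

/-- Induction along the segment `s z`, `0 ≤ s ≤ 1`: the derivative in `s` of one remainder is `z`
times the preceding one, and the first has norm `‖exp (s z)‖ = 1`. -/
theorem norm_exp_sub_sum_le_of_re_eq_zero {z : ℂ} (hz : z.re = 0) (n : ℕ) :
    ‖Complex.exp z - ∑ j ∈ Finset.range n, z ^ j / (j.factorial : ℂ)‖ ≤ ‖z‖ ^ n / n.factorial := by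
  suffices H : ∀ n : ℕ, ∀ s ∈ Set.Icc (0 : ℝ) 1,
      ‖Complex.exp (s * z) - ∑ j ∈ Finset.range n, (s * z) ^ j / (j.factorial : ℂ)‖ ≤
        (s * ‖z‖) ^ n / n.factorial by
    simpa using H n 1 (by simp)
  intro n
  induction n with
  | zero =>
    intro s _
    simp [Complex.norm_exp, hz]
  | succ n ih =>
    have hsum : ∀ s : ℝ, HasDerivAt (fun s : ℝ => ∑ j ∈ Finset.range (n + 1),
        ((s : ℂ) * z) ^ j / (j.factorial : ℂ))
        (z * ∑ j ∈ Finset.range n, ((s : ℂ) * z) ^ j / (j.factorial : ℂ)) s := by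
      intro s
      have h1 : ∀ j : ℕ, HasDerivAt (fun s : ℝ => ((s : ℂ) * z) ^ (j + 1) / ((j + 1).factorial : ℂ))
          (z * (((s : ℂ) * z) ^ j / (j.factorial : ℂ))) s := by
        intro j
        have hs : HasDerivAt (fun s : ℝ => (s : ℂ) * z) (1 * z) s :=
          (Complex.ofRealCLM.hasDerivAt (x := s)).mul_const z
        refine ((hs.fun_pow (j + 1)).div_const ((j + 1).factorial : ℂ)).congr_deriv ?_
        have : (j.factorial : ℂ) ≠ 0 := by exact_mod_cast j.factorial_ne_zero
        have h2 : ((j : ℂ) + 1) ≠ 0 := by exact_mod_cast j.succ_ne_zero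
        rw [Nat.factorial_succ]
        push_cast
        field_simp
      have h2 := HasDerivAt.fun_sum (u := Finset.range n) (fun j _ => h1 j)
      rw [← Finset.mul_sum] at h2
      have h3 := h2.add_const (1 : ℂ)
      refine h3.congr_of_eventuallyEq (Eventually.of_forall fun s => ?_)
      simp only [Finset.sum_range_succ' _ n]
      simp
    have hexp : ∀ s : ℝ, HasDerivAt (fun s : ℝ => Complex.exp ((s : ℂ) * z))
        (z * Complex.exp (s * z)) s := by
      intro s
      have hs : HasDerivAt (fun s : ℝ => (s : ℂ) * z) (1 * z) s :=
        (Complex.ofRealCLM.hasDerivAt (x := s)).mul_const z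
      convert hs.cexp using 1
      ring
    have hder := fun s : ℝ => (hexp s).sub (hsum s)
    have hB : ∀ s : ℝ, HasDerivAt (fun s : ℝ => (s * ‖z‖) ^ (n + 1) / ((n + 1).factorial : ℝ))
        (‖z‖ * ((s * ‖z‖) ^ n / n.factorial)) s := by
      intro s
      have hs : HasDerivAt (fun s : ℝ => s * ‖z‖) (1 * ‖z‖) s := (hasDerivAt_id s).mul_const _
      refine ((hs.fun_pow (n + 1)).div_const ((n + 1).factorial : ℝ)).congr_deriv ?_
      have h2 : ((n : ℝ) + 1) ≠ 0 := by positivity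
      rw [Nat.factorial_succ]
      push_cast
      field_simp
    intro s hs
    refine image_norm_le_of_norm_deriv_right_le_deriv_boundary (a := 0) (b := 1)
      (fun s _ => (hder s).continuousAt.continuousWithinAt)
      (fun s _ => (hder s).hasDerivWithinAt) ?_ hB ?_ hs
    · simp [Finset.sum_range_succ']
    · intro s hs
      rw [← mul_sub, norm_mul]
      exact mul_le_mul_of_nonneg_left (ih s ⟨hs.1, hs.2.le⟩) (norm_nonneg _)

theorem norm_pow_sub_pow_le_of_norm_le_one {a b : ℂ} (ha : ‖a‖ ≤ 1) (hb : ‖b‖ ≤ 1) (M : ℕ) :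
    ‖a ^ M - b ^ M‖ ≤ M * ‖a - b‖ := by
  induction M with
  | zero => simp
  | succ M ih =>
    have h : a ^ (M + 1) - b ^ (M + 1) = a * (a ^ M - b ^ M) + (a - b) * b ^ M := by ring
    rw [h]
    refine (norm_add_le _ _).trans ?_
    rw [norm_mul, norm_mul, norm_pow]
    have h1 : ‖a‖ * ‖a ^ M - b ^ M‖ ≤ 1 * (M * ‖a - b‖) :=
      mul_le_mul ha ih (norm_nonneg _) zero_le_one
    have h2 : ‖a - b‖ * ‖b‖ ^ M ≤ ‖a - b‖ * 1 :=
      mul_le_mul_of_nonneg_left (pow_le_one₀ (norm_nonneg _) hb) (norm_nonneg _)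
    push_cast
    linarith

end ExponentialRemainder

/-! ### Comparing characteristic functions through moments -/

section MomentComparison

variable {Ω Ω' : Type*} [Finite Ω] [MeasurableSpace Ω] [MeasurableSingletonClass Ω]
  [Finite Ω'] [MeasurableSpace Ω'] [MeasurableSingletonClass Ω']

/-- Stopping at an even order makes the bound on the remainder a genuine moment of `Y`, not an
absolute one. -/
theorem norm_integral_cexp_sub_moments_le (μ : Measure Ω) [IsProbabilityMeasure μ] (Y : Ω → ℝ)
    (t : ℝ) (k : ℕ) :
    ‖∫ ω, Complex.exp (t * Y ω * Complex.I) ∂μ - ∑ j ∈ Finset.range (2 * k),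
      (t * Complex.I) ^ j / (j.factorial : ℂ) * ((∫ ω, Y ω ^ j ∂μ : ℝ) : ℂ)‖ ≤
      ∫ ω, |t| ^ (2 * k) * Y ω ^ (2 * k) / (2 * k).factorial ∂μ := by
  have h1 : ∑ j ∈ Finset.range (2 * k),
      (t * Complex.I) ^ j / (j.factorial : ℂ) * ((∫ ω, Y ω ^ j ∂μ : ℝ) : ℂ) =
      ∫ ω, ∑ j ∈ Finset.range (2 * k), (t * Y ω * Complex.I) ^ j / (j.factorial : ℂ) ∂μ := by
    rw [integral_finsetSum _ fun _ _ => Integrable.of_finite]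
    refine Finset.sum_congr rfl fun j _ => ?_
    rw [← integral_complex_ofReal, ← integral_const_mul]
    congr 1
    ext ω
    push_cast
    ring
  rw [h1, ← integral_sub Integrable.of_finite Integrable.of_finite]
  refine (norm_integral_le_integral_norm _).trans
    (integral_mono Integrable.of_finite Integrable.of_finite fun ω => ?_)
  refine (norm_exp_sub_sum_le_of_re_eq_zero (by simp) _).trans_eq ?_
  simp only [norm_mul, Complex.norm_real, Complex.norm_I, mul_one, mul_pow, Real.norm_eq_abs]
  rw [(even_two_mul k).pow_abs (Y ω)]

/-- Both Taylor remainders are bounded by the same `2k`-th moment, which may be evaluated on `Y'`.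
Passing from `t` to `2t` gains the factor `4 ^ (-k)`, and `x ^ (2k) / (2k)! ≤ exp x` for `x = |2 t
Y'|` leaves an exponential moment. -/
theorem norm_integral_cexp_sub_le (μ : Measure Ω) [IsProbabilityMeasure μ] (ν : Measure Ω')
    [IsProbabilityMeasure ν] (Y : Ω → ℝ) (Y' : Ω' → ℝ) (t : ℝ) (k : ℕ)
    (hmom : ∀ j ≤ 2 * k, ∫ ω, Y ω ^ j ∂μ = ∫ ω, Y' ω ^ j ∂ν) :
    ‖∫ ω, Complex.exp (t * Y ω * Complex.I) ∂μ - ∫ ω, Complex.exp (t * Y' ω * Complex.I) ∂ν‖ ≤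
      2 * (1 / 4) ^ k * ∫ ω, (Real.exp (2 * t * Y' ω) + Real.exp (-(2 * t) * Y' ω)) ∂ν := by
  have h1 := norm_integral_cexp_sub_moments_le μ Y t k
  have h2 := norm_integral_cexp_sub_moments_le ν Y' t k
  rw [Finset.sum_congr rfl fun j hj => by rw [hmom j (Finset.mem_range.1 hj).le]] at h1
  have h3 : ∫ ω, |t| ^ (2 * k) * Y ω ^ (2 * k) / (2 * k).factorial ∂μ =
      ∫ ω, |t| ^ (2 * k) * Y' ω ^ (2 * k) / (2 * k).factorial ∂ν := by
    rw [integral_div, integral_const_mul, hmom _ le_rfl, integral_div, integral_const_mul]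
  have h4 : ∫ ω, |t| ^ (2 * k) * Y' ω ^ (2 * k) / (2 * k).factorial ∂ν ≤
      (1 / 4) ^ k * ∫ ω, (Real.exp (2 * t * Y' ω) + Real.exp (-(2 * t) * Y' ω)) ∂ν := by
    rw [← integral_const_mul]
    refine integral_mono Integrable.of_finite Integrable.of_finite fun ω => ?_
    have h5 := Real.pow_div_factorial_le_exp |2 * t * Y' ω| (abs_nonneg _) (2 * k)
    have h6 : Real.exp |2 * t * Y' ω| ≤ Real.exp (2 * t * Y' ω) + Real.exp (-(2 * t) * Y' ω) := by
      have e1 := Real.exp_pos (2 * t * Y' ω)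
      have e2 := Real.exp_pos (-(2 * t) * Y' ω)
      rcases abs_choice (2 * t * Y' ω) with h | h <;> rw [h]
      · linarith
      · rw [← neg_mul]; linarith
    have h7 : |t| ^ (2 * k) * Y' ω ^ (2 * k) / (2 * k).factorial =
        (1 / 4) ^ k * (|2 * t * Y' ω| ^ (2 * k) / (2 * k).factorial) := by
      have h4 : (1 / 4 : ℝ) ^ k * (2 ^ 2) ^ k = 1 := by rw [← mul_pow]; norm_num
      rw [(even_two_mul k).pow_abs, (even_two_mul k).pow_abs, mul_pow, mul_pow, pow_mul 2 2 k]
      linear_combination -(t ^ (2 * k) * Y' ω ^ (2 * k) / (2 * k).factorial) * h4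
    simp only
    rw [h7]
    exact mul_le_mul_of_nonneg_left (h5.trans h6) (by positivity)
  rw [h3] at h1
  have h8 := norm_sub_le_norm_sub_add_norm_sub
    (∫ ω, Complex.exp (t * Y ω * Complex.I) ∂μ) (∑ j ∈ Finset.range (2 * k),
      (t * Complex.I) ^ j / (j.factorial : ℂ) * ((∫ ω, Y' ω ^ j ∂ν : ℝ) : ℂ))
    (∫ ω, Complex.exp (t * Y' ω * Complex.I) ∂ν)
  rw [norm_sub_rev (∑ j ∈ Finset.range (2 * k), _)
    (∫ ω, Complex.exp (t * Y' ω * Complex.I) ∂ν)] at h8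
  linarith

theorem integral_affine_pow_eq (μ : Measure Ω) [IsProbabilityMeasure μ] (ν : Measure Ω')
    [IsProbabilityMeasure ν] {S : Ω → ℝ} {S' : Ω' → ℝ} {k : ℕ}
    (hmom : ∀ j ≤ k, ∫ ω, S ω ^ j ∂μ = ∫ ω, S' ω ^ j ∂ν) (c a : ℝ) {j : ℕ} (hj : j ≤ k) :
    ∫ ω, (c * (S ω - a)) ^ j ∂μ = ∫ ω, (c * (S' ω - a)) ^ j ∂ν := by
  simp only [mul_pow, sub_eq_add_neg, add_pow, integral_const_mul]
  rw [integral_finsetSum _ fun _ _ => Integrable.of_finite,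
    integral_finsetSum _ fun _ _ => Integrable.of_finite]
  congr 1
  refine Finset.sum_congr rfl fun i hi => ?_
  rw [integral_mul_const, integral_mul_const, integral_mul_const, integral_mul_const,
    hmom i (by have := Finset.mem_range.1 hi; omega)]

/-- Indicators are idempotent, so a product of `j` of them is the product over the distinct indices.
The value depends only on `ι` and `θ`, so two families satisfying the hypotheses share these
moments. -/
theorem integral_sum_pow_eq (μ : Measure Ω) [IsProbabilityMeasure μ] {ι : Type*} [Fintype ι]
    [DecidableEq ι] {X : ι → Ω → ℝ} (hX : ∀ i ω, X i ω = 0 ∨ X i ω = 1) {θ : ℝ} {k : ℕ}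
    (hprod : ∀ T : Finset ι, T.card ≤ k → ∫ ω, ∏ i ∈ T, X i ω ∂μ = θ ^ T.card) {j : ℕ}
    (hj : j ≤ k) :
    ∫ ω, (∑ i, X i ω) ^ j ∂μ = ∑ s : Fin j → ι, θ ^ (Finset.univ.image s).card := by
  simp only [Fintype.sum_pow]
  rw [integral_finsetSum _ fun _ _ => Integrable.of_finite]
  refine Finset.sum_congr rfl fun s _ => ?_
  rw [← hprod _ (Finset.card_image_le.trans (by simpa using hj))]
  congr 1
  ext ω
  by_cases h : ∃ l, X (s l) ω = 0
  · obtain ⟨l, hl⟩ := h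
    rw [Finset.prod_eq_zero (Finset.mem_univ l) hl,
      Finset.prod_eq_zero (Finset.mem_image_of_mem s (Finset.mem_univ l)) hl]
  · push Not at h
    have h1 : ∀ l, X (s l) ω = 1 := fun l => (hX _ _).resolve_left (h l)
    rw [Finset.prod_eq_one fun l _ => h1 l, Finset.prod_eq_one]
    intro i hi
    obtain ⟨l, -, rfl⟩ := Finset.mem_image.1 hi
    exact h1 l

end MomentComparison

/-! ### The model of independent coins -/

section BernoulliModel

/-- The Bernoulli distribution with success probability `θ`. -/
noncomputable def coinMeasure (θ : ℝ) : Measure Bool :=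
  ENNReal.ofReal θ • Measure.dirac true + ENNReal.ofReal (1 - θ) • Measure.dirac false

theorem isProbabilityMeasure_coinMeasure {θ : ℝ} (h0 : 0 ≤ θ) (h1 : θ ≤ 1) :
    IsProbabilityMeasure (coinMeasure θ) := by
  refine ⟨?_⟩
  simp only [coinMeasure, Measure.coe_add, Measure.coe_smul, Pi.add_apply, Pi.smul_apply,
    measure_univ, smul_eq_mul, mul_one]
  rw [← ENNReal.ofReal_add h0 (by linarith)]
  simp

theorem integral_coinMeasure {E : Type*} [NormedAddCommGroup E] [NormedSpace ℝ E] [CompleteSpace E] {θ : ℝ}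
    (h0 : 0 ≤ θ) (h1 : θ ≤ 1) (g : Bool → E) :
    ∫ b, g b ∂coinMeasure θ = θ • g true + (1 - θ) • g false := by
  rw [coinMeasure, integral_add_measure, integral_smul_measure, integral_smul_measure,
    integral_dirac, integral_dirac, ENNReal.toReal_ofReal h0, ENNReal.toReal_ofReal (by linarith)]
  · exact (Integrable.of_finite : Integrable g (Measure.dirac true)).smul_measure ENNReal.ofReal_ne_top
  · exact (Integrable.of_finite : Integrable g (Measure.dirac false)).smul_measure ENNReal.ofReal_ne_top

variable {ι : Type*} [Fintype ι] {θ : ℝ}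

/-- The indicator of success. -/
def coinValue (b : Bool) : ℝ := if b then 1 else 0

theorem integral_prod_coinValue (h0 : 0 ≤ θ) (h1 : θ ≤ 1) (T : Finset ι) :
    ∫ ω, ∏ i ∈ T, coinValue (ω i) ∂(Measure.pi fun _ : ι => coinMeasure θ) = θ ^ T.card := by
  classical
  have := isProbabilityMeasure_coinMeasure h0 h1
  have h : ∀ ω : ι → Bool, ∏ i ∈ T, coinValue (ω i) =
      ∏ i, (if i ∈ T then coinValue (ω i) else 1) := fun ω => by
    rw [Finset.prod_ite_mem, Finset.univ_inter]
  simp only [h]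
  rw [integral_fintype_prod_eq_prod (fun i b => if i ∈ T then coinValue b else (1 : ℝ))]
  have h2 : ∀ i, ∫ b, (if i ∈ T then coinValue b else (1 : ℝ)) ∂coinMeasure θ =
      if i ∈ T then θ else 1 := fun i => by
    rw [integral_coinMeasure h0 h1]
    split_ifs <;> simp [coinValue]
  simp only [h2]
  rw [Finset.prod_ite_mem, Finset.univ_inter, Finset.prod_const]

/-- For each coin, `exp x ≤ 1 + x + x ^ 2` when `|x| ≤ 1`; centring kills the linear term, and `1 +
v ≤ exp v` lets the factors be multiplied. -/
theorem integral_exp_coin_le (h0 : 0 ≤ θ) (h1 : θ ≤ 1) {s : ℝ} (hs : |s| ≤ 1) :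
    ∫ ω, Real.exp (s * (∑ i, coinValue (ω i) - Fintype.card ι * θ))
      ∂(Measure.pi fun _ : ι => coinMeasure θ) ≤
      Real.exp (s ^ 2 * (Fintype.card ι * (θ * (1 - θ)))) := by
  have := isProbabilityMeasure_coinMeasure h0 h1
  have h : ∀ ω : ι → Bool, Real.exp (s * (∑ i, coinValue (ω i) - Fintype.card ι * θ)) =
      ∏ i, Real.exp (s * (coinValue (ω i) - θ)) := fun ω => by
    rw [← Real.exp_sum, ← Finset.mul_sum, Finset.sum_sub_distrib]
    simp
  simp only [h]
  rw [integral_fintype_prod_eq_prod (fun _ b => Real.exp (s * (coinValue b - θ)))]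
  simp only [integral_coinMeasure h0 h1, smul_eq_mul, Finset.prod_const, Finset.card_univ]
  have key : ∀ y : ℝ, |y| ≤ 1 → Real.exp (s * y) ≤ 1 + s * y + (s * y) ^ 2 := fun y hy => by
    have := abs_le.1 (Real.abs_exp_sub_one_sub_id_le (x := s * y)
      (by rw [abs_mul]; exact mul_le_one₀ hs (abs_nonneg _) hy))
    linarith [this.2]
  have k1 := key (coinValue true - θ) (by simp [coinValue, abs_le]; constructor <;> linarith)
  have k2 := key (coinValue false - θ) (by simp [coinValue, abs_le]; constructor <;> linarith)
  have k3 : θ * Real.exp (s * (coinValue true - θ)) + (1 - θ) * Real.exp (s * (coinValue false - θ))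
      ≤ Real.exp (s ^ 2 * (θ * (1 - θ))) := by
    refine le_trans ?_ (Real.add_one_le_exp _)
    have k4 := mul_le_mul_of_nonneg_left k1 h0
    have k5 := mul_le_mul_of_nonneg_left k2 (sub_nonneg.2 h1)
    refine (add_le_add k4 k5).trans_eq ?_
    simp only [coinValue, if_true, Bool.false_eq_true, if_false]
    ring
  refine (pow_le_pow_left₀ (by have := sub_nonneg.2 h1; positivity) k3 _).trans_eq ?_
  rw [← Real.exp_nat_mul]
  congr 1
  ring

/-- For one coin, both the characteristic function and the Gaussian factor `exp (-x)` are close to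
`1 - x`, with `x = u ^ 2 θ (1 - θ) / 2`; passing to powers multiplies the error by the number of
coins. The factor `θ (1 - θ)` is kept in the error because `θ` will tend to 0 and only the total
variance stays bounded. -/
theorem norm_integral_cexp_coin_sub_le (h0 : 0 ≤ θ) (h1 : θ ≤ 1) {u : ℝ} (hu : |u| ≤ 1) :
    ‖∫ ω, Complex.exp ((u * (∑ i, coinValue (ω i) - Fintype.card ι * θ) : ℝ) * Complex.I)
      ∂(Measure.pi fun _ : ι => coinMeasure θ) -
      Complex.exp ((-(u ^ 2 * (Fintype.card ι * (θ * (1 - θ)))) / 2 : ℝ))‖ ≤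
      Fintype.card ι * (θ * (1 - θ)) * u ^ 2 * (|u| + u ^ 2) := by
  have := isProbabilityMeasure_coinMeasure h0 h1
  have h : ∀ ω : ι → Bool,
      Complex.exp ((u * (∑ i, coinValue (ω i) - Fintype.card ι * θ) : ℝ) * Complex.I) =
      ∏ i, Complex.exp ((u * (coinValue (ω i) - θ) : ℝ) * Complex.I) := fun ω => by
    rw [← Complex.exp_sum, ← Finset.sum_mul, ← Complex.ofReal_sum, ← Finset.mul_sum,
      Finset.sum_sub_distrib]
    simp
  simp only [h]
  rw [integral_fintype_prod_eq_prod
    (fun _ b => Complex.exp ((u * (coinValue b - θ) : ℝ) * Complex.I))]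
  simp only [Finset.prod_const, Finset.card_univ]
  set a := ∫ b, Complex.exp ((u * (coinValue b - θ) : ℝ) * Complex.I) ∂coinMeasure θ with ha
  set x := u ^ 2 * (θ * (1 - θ)) / 2 with hx
  have hv0 : 0 ≤ θ * (1 - θ) := mul_nonneg h0 (sub_nonneg.2 h1)
  have hv1 : θ * (1 - θ) ≤ 1 := by nlinarith
  have hu2 : u ^ 2 ≤ 1 := (sq_le_one_iff_abs_le_one u).2 hu
  have hx0 : 0 ≤ x := by positivity
  have hx1 : x ≤ 1 := by nlinarith
  have hb : Complex.exp ((-(u ^ 2 * (Fintype.card ι * (θ * (1 - θ)))) / 2 : ℝ)) =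
      Complex.exp ((-x : ℝ)) ^ Fintype.card ι := by
    rw [← Complex.exp_nat_mul]
    congr 1
    rw [hx]
    push_cast
    ring
  have hna : ‖a‖ ≤ 1 := by
    refine (norm_integral_le_integral_norm _).trans ?_
    simp only [Complex.norm_exp_ofReal_mul_I]
    simp
  have hnb : ‖Complex.exp ((-x : ℝ))‖ ≤ 1 := by
    rw [← Complex.ofReal_exp, Complex.norm_real, Real.norm_eq_abs, abs_of_pos (Real.exp_pos _)]
    exact Real.exp_le_one_iff.2 (by linarith)
  have hb1 : ‖Complex.exp ((-x : ℝ)) - ((1 - x : ℝ) : ℂ)‖ ≤ θ * (1 - θ) * u ^ 2 * u ^ 2 := by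
    rw [← Complex.ofReal_exp, ← Complex.ofReal_sub, Complex.norm_real, Real.norm_eq_abs]
    have h5 := Real.abs_exp_sub_one_sub_id_le (x := -x) (by rw [abs_neg, abs_of_nonneg hx0]; exact hx1)
    have h6 : Real.exp (-x) - (1 - x) = Real.exp (-x) - 1 - -x := by ring
    rw [h6]
    refine h5.trans ?_
    have h7 : (-x) ^ 2 = (θ * (1 - θ)) * (θ * (1 - θ)) * (u ^ 2 * u ^ 2) / 4 := by rw [hx]; ring
    have h8 : (θ * (1 - θ)) * (θ * (1 - θ)) * (u ^ 2 * u ^ 2) ≤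
        (θ * (1 - θ)) * 1 * (u ^ 2 * u ^ 2) := by gcongr
    have h9 : 0 ≤ (θ * (1 - θ)) * (u ^ 2 * u ^ 2) := by positivity
    rw [h7]
    linarith
  have ha1 : ‖a - ((1 - x : ℝ) : ℂ)‖ ≤ θ * (1 - θ) * u ^ 2 * |u| := by
    have key : ∀ y : ℝ, |y| ≤ 1 → ‖Complex.exp ((u * y : ℝ) * Complex.I) -
        (1 + (u * y : ℝ) * Complex.I - ((u * y) ^ 2 / 2 : ℝ))‖ ≤ u ^ 2 * |u| * y ^ 2 := by
      intro y hy
      have h5 := norm_exp_sub_sum_le_of_re_eq_zero (z := (u * y : ℝ) * Complex.I) (by simp) 3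
      simp only [Finset.sum_range_succ, Finset.range_zero, Finset.sum_empty, zero_add, pow_zero,
        pow_one, Nat.factorial, Nat.cast_one, div_one, norm_mul, Complex.norm_I, mul_one,
        Complex.norm_real, Real.norm_eq_abs, mul_pow _ Complex.I, Complex.I_sq] at h5
      have h6 : (1 : ℂ) + (u * y : ℝ) * Complex.I - ((u * y) ^ 2 / 2 : ℝ) =
          1 + (u * y : ℝ) * Complex.I + ((u * y : ℝ) : ℂ) ^ 2 * -1 / ((Nat.succ 1 * 1 : ℕ) : ℂ) := by
        push_cast
        ring
      rw [h6]
      refine h5.trans ?_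
      have h7 : (|u| * |y|) ^ 3 = u ^ 2 * |u| * (y ^ 2 * |y|) := by
        rw [← sq_abs u, ← sq_abs y]; ring
      rw [h7]
      have h8 : u ^ 2 * |u| * (y ^ 2 * |y|) ≤ u ^ 2 * |u| * (y ^ 2 * 1) := by gcongr
      refine (div_le_self (by positivity) ?_).trans (by simpa using h8)
      norm_num [Nat.factorial]
    have h5 : a - ((1 - x : ℝ) : ℂ) = ∫ b, (Complex.exp ((u * (coinValue b - θ) : ℝ) * Complex.I) -
        (1 + (u * (coinValue b - θ) : ℝ) * Complex.I - ((u * (coinValue b - θ)) ^ 2 / 2 : ℝ)))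
        ∂coinMeasure θ := by
      rw [integral_sub Integrable.of_finite Integrable.of_finite, ← ha]
      congr 1
      rw [integral_coinMeasure h0 h1]
      simp only [coinValue, if_true, Bool.false_eq_true, if_false, hx, Complex.real_smul]
      push_cast
      ring
    rw [h5]
    refine (norm_integral_le_integral_norm _).trans ?_
    refine (integral_mono (g := fun b => u ^ 2 * |u| * (coinValue b - θ) ^ 2)
      Integrable.of_finite Integrable.of_finite fun b => key _ ?_).trans_eq ?_
    · cases b <;> simp [coinValue, abs_le] <;> constructor <;> linarith
    · rw [integral_coinMeasure h0 h1]
      simp only [coinValue, if_true, Bool.false_eq_true, if_false, smul_eq_mul]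
      ring
  rw [hb]
  refine (norm_pow_sub_pow_le_of_norm_le_one hna hnb _).trans ?_
  have h9 : ‖a - Complex.exp ((-x : ℝ))‖ ≤ θ * (1 - θ) * u ^ 2 * |u| +
      θ * (1 - θ) * u ^ 2 * u ^ 2 := by
    refine (norm_sub_le_norm_sub_add_norm_sub a ((1 - x : ℝ) : ℂ) _).trans (add_le_add ha1 ?_)
    rw [norm_sub_rev]; exact hb1
  refine (mul_le_mul_of_nonneg_left h9 (Nat.cast_nonneg _)).trans_eq ?_
  ring

end BernoulliModel

/-! ### Central limit theorem under limited independence -/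

section LimitTheorem

/-- A central limit theorem for sums of identically distributed Bernoulli variables any `k m` of
which are independent, where `k m → ∞`: the characteristic functions converge. -/
theorem tendsto_integral_cexp_of_prod_eq {Ω : ℕ → Type*} [∀ m, Finite (Ω m)]
    [∀ m, MeasurableSpace (Ω m)] [∀ m, MeasurableSingletonClass (Ω m)]
    (μ : ∀ m, Measure (Ω m)) [∀ m, IsProbabilityMeasure (μ m)]
    {ι : ℕ → Type*} [∀ m, Fintype (ι m)] (X : ∀ m, ι m → Ω m → ℝ)
    (hX : ∀ m i ω, X m i ω = 0 ∨ X m i ω = 1) {θ c : ℕ → ℝ} {k : ℕ → ℕ}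
    (hθ0 : ∀ m, 0 ≤ θ m) (hθ1 : ∀ m, θ m ≤ 1)
    (hk : Tendsto k atTop atTop)
    (hprod : ∀ᶠ m in atTop, ∀ T : Finset (ι m), T.card ≤ k m →
      ∫ ω, ∏ i ∈ T, X m i ω ∂μ m = θ m ^ T.card)
    (hc : Tendsto c atTop (nhds 0))
    (hvar : Tendsto (fun m => c m ^ 2 * (Fintype.card (ι m) * (θ m * (1 - θ m)))) atTop (nhds 1))
    (t : ℝ) :
    Tendsto (fun m => ∫ ω, Complex.exp (t * (c m * (∑ i, X m i ω - Fintype.card (ι m) * θ m) : ℝ) *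
      Complex.I) ∂μ m) atTop (nhds (Complex.exp ((-(t ^ 2) / 2 : ℝ)))) := by
  classical
  have hprob := fun m => isProbabilityMeasure_coinMeasure (hθ0 m) (hθ1 m)
  set ν := fun m => Measure.pi fun _ : ι m => coinMeasure (θ m) with hν
  set Y' : ∀ m, (ι m → Bool) → ℝ := fun m ω =>
    c m * (∑ i, coinValue (ω i) - Fintype.card (ι m) * θ m) with hY'
  have hu : Tendsto (fun m => t * c m) atTop (nhds 0) := by simpa using hc.const_mul t
  have hmodel : Tendsto (fun m => ∫ ω, Complex.exp (t * Y' m ω * Complex.I) ∂ν m) atTop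
      (nhds (Complex.exp ((-(t ^ 2) / 2 : ℝ)))) := by
    have hlim : Tendsto (fun m => Complex.exp
        ((-((t * c m) ^ 2 * (Fintype.card (ι m) * (θ m * (1 - θ m)))) / 2 : ℝ))) atTop
        (nhds (Complex.exp ((-(t ^ 2) / 2 : ℝ)))) := by
      refine (Complex.continuous_exp.tendsto _).comp
        ((Complex.continuous_ofReal.tendsto _).comp ?_)
      have := ((hvar.const_mul (t ^ 2)).neg).div_const 2
      simpa only [mul_one, mul_pow, mul_assoc] using this
    have hbound : Tendsto (fun m => t ^ 2 * (c m ^ 2 * (Fintype.card (ι m) * (θ m * (1 - θ m)))) *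
        (|t * c m| + (t * c m) ^ 2)) atTop (nhds 0) := by
      have := (hvar.const_mul (t ^ 2)).mul (hu.abs.add (hu.pow 2))
      simpa using this
    have hsub : Tendsto (fun m => ∫ ω, Complex.exp (t * Y' m ω * Complex.I) ∂ν m - Complex.exp
        ((-((t * c m) ^ 2 * (Fintype.card (ι m) * (θ m * (1 - θ m)))) / 2 : ℝ))) atTop
        (nhds 0) := by
      refine squeeze_zero_norm' ?_ hbound
      have h1 : ∀ᶠ m in atTop, |t * c m| < 1 := by
        have := hu.abs
        rw [abs_zero] at this
        exact this.eventually_lt_const one_pos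
      filter_upwards [h1] with m hm
      have h2 := norm_integral_cexp_coin_sub_le (ι := ι m) (hθ0 m) (hθ1 m) hm.le
      refine le_trans (le_of_eq ?_) (h2.trans_eq ?_)
      · congr 3
        ext ω
        congr 2
        rw [hY']
        push_cast
        ring
      · ring
    simpa using hsub.add hlim
  have hdiff : Tendsto (fun m => ∫ ω, Complex.exp (t *
      (c m * (∑ i, X m i ω - Fintype.card (ι m) * θ m) : ℝ) * Complex.I) ∂μ m -
      ∫ ω, Complex.exp (t * Y' m ω * Complex.I) ∂ν m) atTop (nhds 0) := by
    rw [Metric.tendsto_nhds]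
    intro ε hε
    -- `4 * t ^ 2` is the square of the exponent `± 2 * t`, and the last `2` eventually bounds the
    -- variance, which tends to 1. As `B` does not depend on `m`, the order `K` can be fixed before
    -- `m` grows.
    set B := Real.exp (4 * t ^ 2 * 2)
    obtain ⟨K, hK⟩ : ∃ K : ℕ, 2 * (1 / 4 : ℝ) ^ K * (B + B) < ε := by
      have : Tendsto (fun K : ℕ => 2 * (1 / 4 : ℝ) ^ K * (B + B)) atTop (nhds 0) := by
        have := ((tendsto_pow_atTop_nhds_zero_of_lt_one (r := (1 / 4 : ℝ)) (by norm_num)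
          (by norm_num)).const_mul 2).mul_const (B + B)
        simpa using this
      exact (this.eventually_lt_const hε).exists
    have h1 : ∀ᶠ m in atTop, |2 * t * c m| < 1 := by
      have := (hc.const_mul (2 * t)).abs
      rw [mul_zero, abs_zero] at this
      exact this.eventually_lt_const one_pos
    filter_upwards [h1, hprod, hk.eventually_ge_atTop (2 * K),
      hvar.eventually_le_const (by norm_num : (1 : ℝ) < 2)] with m h1 h2 h3 h4
    rw [dist_zero_right]
    refine lt_of_le_of_lt ?_ hK
    refine (norm_integral_cexp_sub_le (μ m) (ν m) _ (Y' m) t K fun j hj => ?_).trans ?_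
    · refine integral_affine_pow_eq (μ m) (ν m) (k := 2 * K) (fun j hj => ?_) _ _ hj
      rw [integral_sum_pow_eq (μ m) (hX m) h2 (hj.trans h3),
        integral_sum_pow_eq (ν m) (X := fun i ω => coinValue (ω i)) (k := 2 * K)
          (fun i ω => ?_) (fun T _ => integral_prod_coinValue (hθ0 m) (hθ1 m) T) hj]
      cases ω i <;> simp [coinValue]
    · refine mul_le_mul_of_nonneg_left ?_ (by positivity)
      rw [integral_add Integrable.of_finite Integrable.of_finite]
      have hexp : ∀ s : ℝ, |s * c m| ≤ 1 → s ^ 2 = 4 * t ^ 2 →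
          ∫ ω, Real.exp (s * Y' m ω) ∂ν m ≤ B := by
        intro s hs hs2
        have h5 := integral_exp_coin_le (ι := ι m) (hθ0 m) (hθ1 m) hs
        simp only [hY', ← mul_assoc] at h5 ⊢
        refine h5.trans (Real.exp_le_exp.2 ?_)
        rw [← hs2, mul_pow, mul_assoc (s ^ 2), mul_assoc (s ^ 2), mul_assoc (s ^ 2)]
        refine mul_le_mul_of_nonneg_left ?_ (sq_nonneg s)
        simpa only [mul_assoc] using h4
      refine add_le_add (hexp _ h1.le (by ring)) (hexp _ ?_ (by ring))
      rw [neg_mul, abs_neg]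
      exact h1.le
  simpa using hdiff.add hmodel

end LimitTheorem

/-! ### Conjugacy classes and elements of small degree -/

section ConjugacyClasses

variable {F L : Type*} [Field F] [Field L] [Algebra F L] [Fintype L]

theorem pow_card_pow_natDegree_minpoly (a : L) :
    a ^ (Nat.card F ^ (minpoly F a).natDegree) = a := by
  have : Finite F := Finite.of_injective _ (algebraMap F L).injective
  have := Fintype.ofFinite (IntermediateField.adjoin F {a})
  have h := FiniteField.pow_card (IntermediateField.AdjoinSimple.gen F a)
  rw [← IntermediateField.adjoin.finrank (Algebra.IsIntegral.isIntegral a),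
    ← Module.natCard_eq_pow_finrank (K := F), Nat.card_eq_fintype_card]
  simpa using congrArg (algebraMap (IntermediateField.adjoin F {a}) L) h

variable [Finite F]

theorem card_filter_minpoly_eq [DecidableEq F[X]] (a : L) :
    (Finset.univ.filter fun b : L => minpoly F b = minpoly F a).card = (minpoly F a).natDegree := by
  classical
  have hint : ∀ b : L, IsIntegral F b := fun b => Algebra.IsIntegral.isIntegral b
  rw [← card_rootSet_eq_natDegree (K := L) (Algebra.IsSeparable.isSeparable F a)
    (Normal.splits inferInstance a), ← Set.toFinset_card]
  congr 1
  ext b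
  rw [Finset.mem_filter, Set.mem_toFinset, mem_rootSet_of_ne (minpoly.ne_zero (hint a))]
  refine ⟨fun h => h.2 ▸ minpoly.aeval F b, fun h => ⟨Finset.mem_univ _, ?_⟩⟩
  exact (minpoly.eq_of_irreducible_of_monic (minpoly.irreducible (hint a)) h
    (minpoly.monic (hint a))).symm

/-- An element of degree `e < r` is a root of `X ^ (q ^ e) - X`, and each of the `r` possible `e`
gives at most `q ^ (r - 1)` roots. -/
theorem card_filter_natDegree_minpoly_ne_le (r : ℕ) (hr : Module.finrank F L = r) :
    (Finset.univ.filter fun a : L => (minpoly F a).natDegree ≠ r).card ≤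
      r * Nat.card F ^ (r - 1) := by
  classical
  have hq : 1 < Nat.card F := Finite.one_lt_card
  have hint : ∀ b : L, IsIntegral F b := fun b => Algebra.IsIntegral.isIntegral b
  -- The index `e = 0` is set apart because there the polynomial is zero; no element has degree 0.
  have hsub : (Finset.univ.filter fun a : L => (minpoly F a).natDegree ≠ r) ⊆
      (Finset.range r).biUnion fun e => if e = 0 then ∅ else
        (X ^ (Nat.card F ^ e) - X : L[X]).roots.toFinset := by
    intro a ha
    have hne := (Finset.mem_filter.1 ha).2
    have hle : (minpoly F a).natDegree ≤ r := hr ▸ minpoly.natDegree_le a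
    have hpos := minpoly.natDegree_pos (hint a)
    refine Finset.mem_biUnion.2 ⟨(minpoly F a).natDegree, Finset.mem_range.2 (by omega), ?_⟩
    rw [if_neg hpos.ne', Multiset.mem_toFinset,
      mem_roots (FiniteField.X_pow_card_pow_sub_X_ne_zero L hpos.ne' hq)]
    simp [pow_card_pow_natDegree_minpoly]
  refine (Finset.card_le_card hsub).trans (Finset.card_biUnion_le.trans ?_)
  refine (Finset.sum_le_card_nsmul _ _ (Nat.card F ^ (r - 1)) fun e he => ?_).trans (by simp)
  split_ifs with h0
  · simp
  · refine (Multiset.toFinset_card_le _).trans ((card_roots' _).trans ?_)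
    rw [FiniteField.X_pow_card_pow_sub_X_natDegree_eq L h0 hq]
    exact Nat.pow_le_pow_right (by omega) (by have := Finset.mem_range.1 he; omega)

theorem exists_conjugacy_representatives (r : ℕ) :
    ∃ S : Finset L, Set.InjOn (minpoly F) (S : Set L) ∧
      (∀ a ∈ S, (minpoly F a).natDegree = r) ∧
      ∀ g : L → ℝ, (∀ a b, minpoly F a = minpoly F b → g a = g b) →
        ∑ a with (minpoly F a).natDegree = r, g a = r * ∑ a ∈ S, g a := by
  classical
  set A := Finset.univ.filter fun a : L => (minpoly F a).natDegree = r with hA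
  have hrep : ∀ P ∈ A.image (minpoly F), ∃ a : L, a ∈ A ∧ minpoly F a = P := fun P hP => by
    simpa using hP
  choose! rep hrepA hrep using hrep
  have hinj : Set.InjOn rep (A.image (minpoly F) : Finset F[X]) := fun P hP Q hQ h => by
    rw [← hrep P hP, ← hrep Q hQ, h]
  refine ⟨(A.image (minpoly F)).image rep, ?_, ?_, fun g hg => ?_⟩
  · intro a ha b hb h
    obtain ⟨P, hP, rfl⟩ := Finset.mem_image.1 ha
    obtain ⟨Q, hQ, rfl⟩ := Finset.mem_image.1 hb
    rw [hrep P hP, hrep Q hQ] at h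
    rw [h]
  · intro a ha
    obtain ⟨P, hP, rfl⟩ := Finset.mem_image.1 ha
    exact (Finset.mem_filter.1 (hrepA P hP)).2
  · rw [Finset.sum_image hinj, Finset.mul_sum,
      ← Finset.sum_fiberwise_of_maps_to (fun a ha => Finset.mem_image_of_mem (minpoly F) ha)]
    refine Finset.sum_congr rfl fun P hP => ?_
    have hdeg := (Finset.mem_filter.1 (hrepA P hP)).2
    have hfib : (A.filter fun a => minpoly F a = P) =
        Finset.univ.filter fun b : L => minpoly F b = minpoly F (rep P) := by
      ext b
      rw [hrep P hP, Finset.mem_filter, hA, Finset.mem_filter, Finset.mem_filter]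
      refine ⟨fun h => ⟨Finset.mem_univ _, h.2⟩, fun h => ⟨⟨Finset.mem_univ _, ?_⟩, h.2⟩⟩
      rw [h.2, ← hrep P hP, hdeg]
    rw [Finset.sum_congr rfl (g := fun _ => g (rep P)) fun a ha => hg a (rep P) (by
      rw [hrep P hP]; exact (Finset.mem_filter.1 ha).2), Finset.sum_const, hfib,
      card_filter_minpoly_eq, hdeg, nsmul_eq_mul]

end ConjugacyClasses

/-! ### Trace indicators and their correlations -/

section TraceIndicator

variable {F L : Type*} [Field F] [Field L] [Algebra F L] (p : ℕ) [Fact p.Prime]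
  [Algebra (ZMod p) L]

open Classical in
/-- The indicator of the vanishing of the absolute trace of `f(a)`. -/
noncomputable def traceIndicator (a : L) (f : F[X]) : ℝ :=
  if Algebra.trace (ZMod p) L (aeval a f) = 0 then 1 else 0

theorem traceIndicator_eq_zero_or_one (a : L) (f : F[X]) :
    traceIndicator p a f = 0 ∨ traceIndicator p a f = 1 := by
  rw [traceIndicator]; split_ifs <;> simp

theorem abs_asN_sub_sum_traceIndicator_le [CharP F p] [Fintype L] (f : F[X]) :
    |asN F p L f - ∑ a : L, traceIndicator p a f| ≤ 1 := by
  have h := abs_asN_sub_le F p L f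
  have hp : (p : ℝ) ≠ 0 := by exact_mod_cast (Fact.out : p.Prime).ne_zero
  rw [card_artinSchreier_points p L (fun a => aeval a f)] at h
  push_cast at h
  rwa [mul_div_cancel_left₀ _ hp] at h

theorem abs_asN_sub_decomposition_le [CharP F p] [Fintype L] {r : ℕ} (f : F[X]) {S : Finset L}
    (hS : ∑ a : L with (minpoly F a).natDegree = r, traceIndicator p a f =
      r * ∑ a ∈ S, traceIndicator p a f)
    (hScard : ((Finset.univ.filter fun a : L => (minpoly F a).natDegree = r).card : ℝ) =
      r * S.card) :
    |asN F p L f - (Fintype.card L : ℝ) / p -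
      r * (∑ a ∈ S, traceIndicator p a f - S.card * (1 / p))| ≤
      1 + |∑ a : L with (minpoly F a).natDegree ≠ r, (traceIndicator p a f - 1 / p)| := by
  have h1 := abs_asN_sub_sum_traceIndicator_le (L := L) p f
  have h2 := Finset.sum_filter_add_sum_filter_not (Finset.univ : Finset L)
    (fun a => (minpoly F a).natDegree = r) fun a => traceIndicator p a f - 1 / p
  rw [Finset.sum_sub_distrib _ _ (s := Finset.univ.filter fun a : L =>
    (minpoly F a).natDegree = r), hS, Finset.sum_const, Finset.sum_sub_distrib _ _
    (s := Finset.univ), Finset.sum_const, nsmul_eq_mul, nsmul_eq_mul, hScard,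
    Finset.card_univ] at h2
  have h3 : asN F p L f - (Fintype.card L : ℝ) / p -
      r * (∑ a ∈ S, traceIndicator p a f - S.card * (1 / p)) =
      (asN F p L f - ∑ a : L, traceIndicator p a f) +
      ∑ a : L with (minpoly F a).natDegree ≠ r, (traceIndicator p a f - 1 / p) := by
    linear_combination -h2
  rw [h3]
  exact (abs_add_le _ _).trans (add_le_add_left h1 _)

variable [Finite L]

/-- Conjugate elements differ by an automorphism over `F`, which commutes with `f` and preserves the
absolute trace. -/
theorem traceIndicator_eq_of_minpoly_eq {a b : L} (h : minpoly F a = minpoly F b) (f : F[X]) :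
    traceIndicator p a f = traceIndicator p b f := by
  have : Finite F := Finite.of_injective _ (algebraMap F L).injective
  obtain ⟨σ, rfl⟩ := (Normal.minpoly_eq_iff_mem_orbit L).1 h
  have h1 : aeval (σ • b) f = σ (aeval b f) := aeval_algHom_apply σ b f
  let σ' : L ≃ₐ[ZMod p] L := AlgEquiv.ofRingEquiv (f := (σ : L ≃+* L)) fun x =>
    RingHom.congr_fun (Subsingleton.elim
      ((σ : L →+* L).comp (algebraMap (ZMod p) L)) (algebraMap (ZMod p) L)) x
  have h2 : Algebra.trace (ZMod p) L (σ (aeval b f)) = Algebra.trace (ZMod p) L (aeval b f) :=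
    Algebra.trace_eq_of_algEquiv σ' _
  rw [traceIndicator, traceIndicator, h1, h2]

variable [Finite F] [Algebra (ZMod p) F] [IsScalarTower (ZMod p) F L]

theorem integral_prod_traceIndicator (hp : ¬ p ∣ Module.finrank F L) {T : Finset L}
    (hT : Set.InjOn (minpoly F) (T : Set L)) {d : ℕ}
    (hd : ∑ b ∈ T, (minpoly F b).natDegree ≤ d) :
    ∫ f : MonicOfDegree F d, ∏ a ∈ T, traceIndicator p a f.1 ∂uniformMonic F d =
      (1 / p : ℝ) ^ T.card := by
  classical
  have := Fintype.ofFinite (MonicOfDegree F d)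
  set A : Set (MonicOfDegree F d) :=
    {f | ∀ a ∈ T, Algebra.trace (ZMod p) L (aeval a f.1) = 0} with hA
  have h1 : ∀ f : MonicOfDegree F d, ∏ a ∈ T, traceIndicator p a f.1 =
      A.indicator (1 : MonicOfDegree F d → ℝ) f := fun f => by
    simp only [traceIndicator]
    rw [Finset.prod_ite_zero, Set.indicator_apply, Finset.prod_const_one]
    rfl
  simp only [h1]
  rw [integral_indicator_one (MeasurableSet.of_discrete), Measure.real, uniformMonic,
    uniformOn_univ, Measure.count_apply_finite A A.toFinite, ENNReal.toReal_div]
  have h2 := card_monicOfDegree_trace_eq_zero hp hT hd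
  have h3 : A.toFinite.toFinset.card = Nat.card A := (Nat.card_eq_card_finite_toFinset _).symm
  have h4 : Nat.card A * p ^ T.card = Fintype.card (MonicOfDegree F d) := by
    rw [← Nat.card_eq_fintype_card]; exact h2
  have h5 : (Fintype.card (MonicOfDegree F d) : ℝ) ≠ 0 := by
    exact_mod_cast Fintype.card_ne_zero
  have hp0 : (p : ℝ) ≠ 0 := by exact_mod_cast (Fact.out : p.Prime).ne_zero
  rw [h3, ENNReal.toReal_natCast, ENNReal.toReal_natCast, div_eq_iff h5, one_div, inv_pow,
    ← h4]
  push_cast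
  field_simp

theorem integral_traceIndicator (hp : ¬ p ∣ Module.finrank F L) (a : L) {d : ℕ}
    (hd : Module.finrank F L ≤ d) :
    ∫ f : MonicOfDegree F d, traceIndicator p a f.1 ∂uniformMonic F d = 1 / p := by
  have h := integral_prod_traceIndicator p hp (T := {a}) (d := d) (by simp)
    (by simpa using (minpoly.natDegree_le a).trans hd)
  simpa using h

/-- Indicators at non-conjugate points are uncorrelated; at conjugate points they coincide, and the
variance is at most `1 / p`. -/
theorem integral_traceIndicator_sub_mul_le [DecidableEq F[X]] (hp : ¬ p ∣ Module.finrank F L)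
    (a b : L) {d : ℕ} (hd : 2 * Module.finrank F L ≤ d) :
    ∫ f : MonicOfDegree F d, (traceIndicator p a f.1 - 1 / p) * (traceIndicator p b f.1 - 1 / p)
      ∂uniformMonic F d ≤ if minpoly F b = minpoly F a then (1 / p : ℝ) else 0 := by
  classical
  have ha := integral_traceIndicator p hp a (d := d) (by omega)
  have hb := integral_traceIndicator p hp b (d := d) (by omega)
  have hexp : ∫ f : MonicOfDegree F d,
      (traceIndicator p a f.1 - 1 / p) * (traceIndicator p b f.1 - 1 / p) ∂uniformMonic F d =
      ∫ f : MonicOfDegree F d, traceIndicator p a f.1 * traceIndicator p b f.1 ∂uniformMonic F d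
        - 1 / p * (1 / p) := by
    have : ∀ f : MonicOfDegree F d,
        (traceIndicator p a f.1 - 1 / p) * (traceIndicator p b f.1 - 1 / p) =
        (traceIndicator p a f.1 * traceIndicator p b f.1 - 1 / p * traceIndicator p a f.1 -
          1 / p * traceIndicator p b f.1) + 1 / p * (1 / p) := fun f => by ring
    simp only [this]
    rw [integral_add Integrable.of_finite Integrable.of_finite,
      integral_sub Integrable.of_finite Integrable.of_finite,
      integral_sub Integrable.of_finite Integrable.of_finite, integral_const_mul,
      integral_const_mul, ha, hb]
    simp
  rw [hexp]
  split_ifs with h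
  · have hmul : ∀ f : MonicOfDegree F d, traceIndicator p a f.1 * traceIndicator p b f.1 =
        traceIndicator p a f.1 := fun f => by
      rw [traceIndicator_eq_of_minpoly_eq p h f.1]
      rcases traceIndicator_eq_zero_or_one p a f.1 with h | h <;> simp [h]
    simp only [hmul, ha]
    have : (0 : ℝ) ≤ 1 / p * (1 / p) := by positivity
    linarith
  · have hab : a ≠ b := fun hab => h (by rw [hab])
    have h2 := integral_prod_traceIndicator p hp (T := {a, b}) (d := d) (by
      intro x hx y hy hxy
      simp only [Finset.coe_insert, Finset.coe_singleton, Set.mem_insert_iff,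
        Set.mem_singleton_iff] at hx hy
      rcases hx with rfl | rfl <;> rcases hy with rfl | rfl
      · rfl
      · exact absurd hxy.symm h
      · exact absurd hxy h
      · rfl) (by
      rw [Finset.sum_pair hab]
      have h3 := minpoly.natDegree_le (A := F) a
      have h4 := minpoly.natDegree_le (A := F) b
      omega)
    simp only [Finset.prod_pair hab, Finset.card_pair hab] at h2
    rw [h2]
    exact le_of_eq (by ring)

/-- Each `a` is correlated with at most `[L : F]` elements, its conjugates. This makes the elements
of small degree negligible; for `r ≥ 2` their number alone, bounded by `r q^(r-1)`, would not
suffice. -/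
theorem integral_sq_sum_traceIndicator_le (hp : ¬ p ∣ Module.finrank F L) (A : Finset L) {d : ℕ}
    (hd : 2 * Module.finrank F L ≤ d) :
    ∫ f : MonicOfDegree F d, (∑ a ∈ A, (traceIndicator p a f.1 - 1 / p)) ^ 2 ∂uniformMonic F d ≤
      A.card * (Module.finrank F L / p) := by
  classical
  have := Fintype.ofFinite L
  simp only [sq, Finset.sum_mul_sum]
  rw [integral_finsetSum _ fun _ _ => Integrable.of_finite, ← nsmul_eq_mul]
  refine Finset.sum_le_card_nsmul _ _ _ fun a _ => ?_
  rw [integral_finsetSum _ fun _ _ => Integrable.of_finite]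
  refine (Finset.sum_le_sum fun b _ => integral_traceIndicator_sub_mul_le p hp a b hd).trans ?_
  refine (Finset.sum_le_univ_sum_of_nonneg fun b => by split_ifs <;> positivity).trans ?_
  rw [← Finset.sum_filter, Finset.sum_const, card_filter_minpoly_eq, nsmul_eq_mul, mul_one_div]
  gcongr
  exact minpoly.natDegree_le a

theorem integral_abs_le_sqrt {Ω : Type*} [Finite Ω] [MeasurableSpace Ω]
    [MeasurableSingletonClass Ω] (μ : Measure Ω) [IsProbabilityMeasure μ] (Z : Ω → ℝ) :
    ∫ ω, |Z ω| ∂μ ≤ √(∫ ω, Z ω ^ 2 ∂μ) := by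
  refine Real.le_sqrt_of_sq_le ?_
  set e := ∫ ω, |Z ω| ∂μ with he
  have h : 0 ≤ ∫ ω, (|Z ω| - e) ^ 2 ∂μ := integral_nonneg fun ω => sq_nonneg _
  have h2 : ∫ ω, (|Z ω| - e) ^ 2 ∂μ = ∫ ω, Z ω ^ 2 ∂μ - e ^ 2 := by
    have h3 : ∀ ω, (|Z ω| - e) ^ 2 = Z ω ^ 2 - 2 * e * |Z ω| + e ^ 2 := fun ω => by
      rw [← sq_abs (Z ω)]; ring
    simp only [h3]
    rw [integral_add Integrable.of_finite Integrable.of_finite,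
      integral_sub Integrable.of_finite Integrable.of_finite, integral_const_mul, ← he]
    simp
    ring
  linarith

end TraceIndicator

/-! ### Decomposition of the point count and passage to the limit -/

/-- The normalised point count is, up to a remainder, a centred sum of indicators attached to the
closed points of degree `r`, and any few of these indicators are independent. -/
theorem exists_asN_decomposition (F L : Type*) [Field F] [Finite F] [Field L] [Algebra F L]
    (p r d : ℕ) [Fact p.Prime] [CharP F p] (hr : 0 < r) (hL : Module.finrank F L = r) :
    ∃ (S : Finset L) (X : S → MonicOfDegree F d → ℝ) (R : MonicOfDegree F d → ℝ),
      (∀ i f, X i f = 0 ∨ X i f = 1) ∧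
      (¬ p ∣ r → ∀ T : Finset S, T.card ≤ d / r →
        ∫ f, ∏ i ∈ T, X i f ∂uniformMonic F d = (1 / p : ℝ) ^ T.card) ∧
      (∀ f, asN F p L f.1 - (Nat.card F : ℝ) ^ r / p =
        r * (∑ i, X i f - Fintype.card S * (1 / p)) + R f) ∧
      (r * S.card ≤ Nat.card F ^ r) ∧
      (Nat.card F ^ r ≤ r * S.card + r * Nat.card F ^ (r - 1)) ∧
      (¬ p ∣ r → 2 * r ≤ d → ∫ f, |R f| ∂uniformMonic F d ≤
        1 + √(r * (Nat.card F : ℝ) ^ (r - 1) * (r / p))) := by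
  classical
  have : FiniteDimensional F L := Module.finite_of_finrank_pos (hL ▸ hr)
  have : Finite L := Module.finite_of_finite F
  have := Fintype.ofFinite L
  have : CharP L p := charP_of_injective_algebraMap (algebraMap F L).injective p
  let : Algebra (ZMod p) F := ZMod.algebra F p
  let : Algebra (ZMod p) L := ZMod.algebra L p
  have : IsScalarTower (ZMod p) F L :=
    IsScalarTower.of_algebraMap_eq' (Subsingleton.elim _ _)
  have hcardL : Fintype.card L = Nat.card F ^ r := by
    rw [← Nat.card_eq_fintype_card, Module.natCard_eq_pow_finrank (K := F), hL]
  obtain ⟨S, hSinj, hSdeg, hS⟩ := exists_conjugacy_representatives (F := F) (L := L) r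
  have hSf := fun f : F[X] => hS (fun a => traceIndicator p a f)
    fun a b h => traceIndicator_eq_of_minpoly_eq p h f
  have hScard : ((Finset.univ.filter fun a : L => (minpoly F a).natDegree = r).card : ℝ) =
      r * S.card := by
    simpa using hS (fun _ => 1) fun _ _ _ => rfl
  have hScard' : (Finset.univ.filter fun a : L => (minpoly F a).natDegree = r).card =
      r * S.card := by exact_mod_cast hScard
  have htotal := Finset.card_filter_add_card_filter_not (s := (Finset.univ : Finset L))
    fun a => (minpoly F a).natDegree = r
  rw [hScard', Finset.card_univ, hcardL] at htotal
  have hlow : (Finset.univ.filter fun a : L => ¬ (minpoly F a).natDegree = r).card ≤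
      r * Nat.card F ^ (r - 1) := card_filter_natDegree_minpoly_ne_le r hL
  -- The remainder is defined as the difference, so the decomposition is an identity and all content
  -- is in the bound on its mean.
  refine ⟨S, fun i f => traceIndicator p i.1 f.1, fun f => asN F p L f.1 -
    (Nat.card F : ℝ) ^ r / p - r * (∑ i : S, traceIndicator p i.1 f.1 -
      Fintype.card S * (1 / p)), fun i f => traceIndicator_eq_zero_or_one p _ _, ?_,
    fun f => by ring, by omega, by omega, ?_⟩
  · intro hp T hT
    have h := integral_prod_traceIndicator (F := F) (L := L) p (by rwa [hL])
      (T := T.map ⟨Subtype.val, Subtype.val_injective⟩) (d := d) (by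
        intro a ha b hb hab
        obtain ⟨i, -, rfl⟩ := Finset.mem_map.1 ha
        obtain ⟨j, -, rfl⟩ := Finset.mem_map.1 hb
        exact hSinj i.2 j.2 hab) (by
        rw [Finset.sum_map, Finset.sum_congr rfl fun i _ => hSdeg i.1 i.2, Finset.sum_const,
          smul_eq_mul]
        exact (Nat.mul_le_mul_right r hT).trans (Nat.div_mul_le_self d r))
    simpa using h
  · intro hp hd
    have hle : ∀ f : MonicOfDegree F d, |asN F p L f.1 - (Nat.card F : ℝ) ^ r / p -
        r * (∑ i : S, traceIndicator p i.1 f.1 - Fintype.card S * (1 / p))| ≤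
        1 + |∑ a : L with (minpoly F a).natDegree ≠ r, (traceIndicator p a f.1 - 1 / p)| := by
      intro f
      have h := abs_asN_sub_decomposition_le p f.1 (hSf f.1) hScard
      rw [hcardL] at h
      push_cast at h
      rwa [Finset.sum_coe_sort S fun a => traceIndicator p a f.1, Fintype.card_coe]
    refine (integral_mono Integrable.of_finite Integrable.of_finite hle).trans ?_
    rw [integral_add Integrable.of_finite Integrable.of_finite]
    refine add_le_add (by simp) ((integral_abs_le_sqrt _ _).trans (Real.sqrt_le_sqrt ?_))
    refine (integral_sq_sum_traceIndicator_le p (by rwa [hL]) _ (by rwa [hL])).trans ?_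
    rw [hL]
    gcongr
    exact_mod_cast hlow

/-- Convergence of characteristic functions up to an error that tends to `0` in mean gives
convergence in distribution. -/
theorem tendstoInDistribution_of_tendsto_integral_cexp {Ω : ℕ → Type*} [∀ m, Finite (Ω m)]
    [∀ m, MeasurableSpace (Ω m)] [∀ m, MeasurableSingletonClass (Ω m)]
    (μ : ∀ m, Measure (Ω m)) [∀ m, IsProbabilityMeasure (μ m)] (Z Y : ∀ m, Ω m → ℝ)
    (herr : Tendsto (fun m => ∫ ω, |Z m ω - Y m ω| ∂μ m) atTop (nhds 0))
    (hY : ∀ t : ℝ, Tendsto (fun m => ∫ ω, Complex.exp (t * (Y m ω : ℝ) * Complex.I) ∂μ m) atTop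
      (nhds (Complex.exp ((-(t ^ 2) / 2 : ℝ))))) :
    TendstoInDistribution Z atTop (id : ℝ → ℝ) μ (gaussianReal 0 1) where
  forall_aemeasurable m := (measurable_of_finite (Z m)).aemeasurable
  tendsto := by
    refine ProbabilityMeasure.tendsto_iff_tendsto_charFun.2 fun t => ?_
    have hgauss : charFun ((gaussianReal 0 1).map (id : ℝ → ℝ)) t =
        Complex.exp ((-(t ^ 2) / 2 : ℝ)) := by
      rw [Measure.map_id, charFun_gaussianReal]
      congr 1
      push_cast
      simp
      ring
    have hZ : ∀ m, charFun ((μ m).map (Z m)) t =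
        ∫ ω, Complex.exp (t * (Z m ω : ℝ) * Complex.I) ∂μ m := fun m => by
      rw [charFun_apply_real, integral_map (measurable_of_finite (Z m)).aemeasurable]
      exact Continuous.aestronglyMeasurable (by fun_prop)
    simp only [ProbabilityMeasure.coe_mk, hZ, hgauss]
    have hdiff : Tendsto (fun m => ∫ ω, Complex.exp (t * (Z m ω : ℝ) * Complex.I) ∂μ m -
        ∫ ω, Complex.exp (t * (Y m ω : ℝ) * Complex.I) ∂μ m) atTop (nhds 0) := by
      refine squeeze_zero_norm (a := fun m => |t| * ∫ ω, |Z m ω - Y m ω| ∂μ m) (fun m => ?_)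
        (by simpa using herr.const_mul |t|)
      rw [← integral_sub Integrable.of_finite Integrable.of_finite, ← integral_const_mul]
      refine (norm_integral_le_integral_norm _).trans
        (integral_mono Integrable.of_finite Integrable.of_finite fun ω => ?_)
      have h1 : Complex.exp (t * (Z m ω : ℝ) * Complex.I) =
          Complex.exp (t * (Y m ω : ℝ) * Complex.I) *
            Complex.exp (Complex.I * (t * (Z m ω - Y m ω) : ℝ)) := by
        rw [← Complex.exp_add]
        congr 1
        push_cast
        ring
      have h2 : ‖Complex.exp (t * (Y m ω : ℝ) * Complex.I)‖ = 1 := by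
        rw [← Complex.ofReal_mul, Complex.norm_exp_ofReal_mul_I]
      simp only
      rw [h1, ← mul_sub_one, norm_mul, h2, one_mul, ← abs_mul]
      exact Real.norm_exp_I_mul_ofReal_sub_one_le
    simpa using hdiff.add (hY t)

theorem normalization_sq {p q : ℝ} {r : ℕ} (hp : 0 < p) (hq : 0 < q) (hr : 0 < r) :
    (p ^ (1 / 2 : ℝ) * (r : ℝ) ^ (-1 / 2 : ℝ) * q ^ (-(r : ℝ) / 2)) ^ 2 = p / (r * q ^ r) := by
  have hr' : (0 : ℝ) < r := by exact_mod_cast hr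
  have h1 : (p ^ (1 / 2 : ℝ)) ^ 2 = p := by
    rw [← Real.rpow_natCast, ← Real.rpow_mul hp.le]; norm_num
  have h2 : ((r : ℝ) ^ (-1 / 2 : ℝ)) ^ 2 = (r : ℝ)⁻¹ := by
    rw [← Real.rpow_natCast, ← Real.rpow_mul hr'.le]; norm_num [Real.rpow_neg_one]
  have h3 : (q ^ (-(r : ℝ) / 2)) ^ 2 = (q ^ r)⁻¹ := by
    rw [← Real.rpow_natCast, ← Real.rpow_mul hq.le, ← Real.rpow_natCast q r, ← Real.rpow_neg hq.le]
    congr 1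
    push_cast
    ring
  rw [mul_pow, mul_pow, h1, h2, h3]
  field_simp

theorem theorem8 (r : ℕ) (hr : 0 < r) (p n d : ℕ → ℕ)
    (hp : ∀ m, (p m).Prime)
    (hp_lim : Tendsto p atTop atTop) (hd_lim : Tendsto d atTop atTop)
    (hnr : (∀ m, 1 < n m) ∨ 1 < r)
    (F : ℕ → Type*) [∀ m, Field (F m)] [∀ m, Finite (F m)]
    (hF : ∀ m, Nat.card (F m) = p m ^ n m)
    (L : ℕ → Type*) [∀ m, Field (L m)] [∀ m, Algebra (F m) (L m)]
    (hL : ∀ m, Module.finrank (F m) (L m) = r) :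
    TendstoInDistribution
      (fun (m : ℕ) (f : MonicOfDegree (F m) (d m)) =>
        (p m : ℝ) ^ (1 / 2 : ℝ) * (r : ℝ) ^ (-1 / 2 : ℝ) *
          ((p m ^ n m : ℕ) : ℝ) ^ (-(r : ℝ) / 2) *
          (asN (F m) (p m) (L m) f.1 - ((p m ^ n m : ℕ) : ℝ) ^ r / (p m : ℝ)))
      atTop (id : ℝ → ℝ)
      (fun m => uniformMonic (F m) (d m)) (gaussianReal 0 1) := by
  have hfact : ∀ m, Fact (p m).Prime := fun m => ⟨hp m⟩
  have hn : ∀ m, 0 < n m := fun m => by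
    by_contra h0
    have h1 := hF m
    rw [Nat.eq_zero_of_not_pos h0, pow_zero] at h1
    have : 1 < Nat.card (F m) := Finite.one_lt_card
    omega
  have hchar : ∀ m, CharP (F m) (p m) := fun m => by
    have := Fintype.ofFinite (F m)
    refine charP_of_card_eq_prime_pow (f := n m) ?_
    rw [← Nat.card_eq_fintype_card, hF]
  choose S X R hX hprod hdecomp hle hge hR using fun m =>
    exists_asN_decomposition (F m) (L m) (p m) r (d m) hr (hL m)
  have hr' : (0 : ℝ) < r := by exact_mod_cast hr
  have hp0 : ∀ m, (0 : ℝ) < p m := fun m => by exact_mod_cast (hp m).pos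
  have hp1 : ∀ m, (1 : ℝ) ≤ p m := fun m => by exact_mod_cast (hp m).one_lt.le
  set q : ℕ → ℝ := fun m => ((p m ^ n m : ℕ) : ℝ) with hq
  have hqcard : ∀ m, (Nat.card (F m) : ℝ) = q m := fun m => by rw [hF]
  have hpq : ∀ m, (p m : ℝ) ≤ q m := fun m => by
    have : p m ≤ p m ^ n m := Nat.le_self_pow (hn m).ne' _
    change (p m : ℝ) ≤ ((p m ^ n m : ℕ) : ℝ)
    exact_mod_cast this
  have hq0 : ∀ m, 0 < q m := fun m => (hp0 m).trans_le (hpq m)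
  -- The only use of `n > 1` or `r > 1`: it gives `N ^ 2 ≤ 1 / p`, so that a single indicator and
  -- the error from infinity vanish in the limit.
  have hqr : ∀ m, (p m : ℝ) ^ 2 ≤ q m ^ r := fun m => by
    have h2 : 2 ≤ n m * r := by
      rcases hnr with h | h
      · exact Nat.mul_le_mul (h m) hr
      · exact Nat.mul_le_mul (hn m) h
    have h3 : p m ^ 2 ≤ (p m ^ n m) ^ r := by
      rw [← pow_mul]; exact Nat.pow_le_pow_right (hp m).pos h2
    change (p m : ℝ) ^ 2 ≤ ((p m ^ n m : ℕ) : ℝ) ^ r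
    exact_mod_cast h3
  have hqsucc : ∀ m, q m ^ r = q m * q m ^ (r - 1) := fun m => by
    rw [← pow_succ', Nat.sub_add_cancel hr]
  set N : ℕ → ℝ := fun m => (p m : ℝ) ^ (1 / 2 : ℝ) * (r : ℝ) ^ (-1 / 2 : ℝ) *
    q m ^ (-(r : ℝ) / 2) with hN
  have hNsq : ∀ m, N m ^ 2 = p m / (r * q m ^ r) := fun m =>
    normalization_sq (hp0 m) (hq0 m) hr
  have hN0 : ∀ m, 0 ≤ N m := fun m => by have := hq0 m; positivity
  have hpinv : Tendsto (fun m => (1 / p m : ℝ)) atTop (nhds 0) := by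
    simpa only [one_div, Function.comp_def] using
      tendsto_inv_atTop_zero.comp (tendsto_natCast_atTop_atTop.comp hp_lim)
  have hN_lim : Tendsto N atTop (nhds 0) := by
    have h1 : Tendsto (fun m => √(1 / p m : ℝ)) atTop (nhds 0) := by
      simpa only [Function.comp_def, Real.sqrt_zero] using (Real.continuous_sqrt.tendsto 0).comp hpinv
    refine squeeze_zero hN0 (fun m => Real.le_sqrt_of_sq_le ?_) h1
    rw [hNsq, div_le_div_iff₀ (mul_pos hr' (pow_pos (hq0 m) r)) (hp0 m), one_mul, ← sq]
    refine (hqr m).trans (le_mul_of_one_le_left (by have := hq0 m; positivity) ?_)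
    exact_mod_cast hr
  have hp_gt : ∀ᶠ m in atTop, ¬ p m ∣ r := by
    filter_upwards [hp_lim.eventually_gt_atTop r] with m hm hdvd
    exact absurd (Nat.le_of_dvd hr hdvd) (by omega)
  have hsmall : ∀ m, q m ^ (r - 1) / q m ^ r ≤ 1 / p m := fun m => by
    have h1 : 0 < q m ^ (r - 1) := pow_pos (hq0 m) _
    rw [hqsucc, div_le_div_iff₀ (mul_pos (hq0 m) h1) (hp0 m), one_mul, mul_comm]
    exact mul_le_mul_of_nonneg_right (hpq m) h1.le
  refine tendstoInDistribution_of_tendsto_integral_cexp _ _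
    (fun m f => N m * r * (∑ i, X m i f - Fintype.card (S m) * (1 / p m))) ?_ fun t => ?_
  · have herr : ∀ m, ∀ f : MonicOfDegree (F m) (d m),
        |N m * (asN (F m) (p m) (L m) f.1 - q m ^ r / p m) -
          N m * r * (∑ i, X m i f - Fintype.card (S m) * (1 / p m))| = N m * |R m f| := by
      intro m f
      have h := hdecomp m f
      rw [hqcard] at h
      rw [h, mul_add, ← mul_assoc, add_sub_cancel_left, abs_mul, abs_of_nonneg (hN0 m)]
    have hbound : Tendsto (fun m => N m + √(r * (1 / p m))) atTop (nhds 0) := by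
      have h1 : Tendsto (fun m => √(r * (1 / p m : ℝ))) atTop (nhds 0) := by
        have h2 : Tendsto (fun m => (r * (1 / p m) : ℝ)) atTop (nhds 0) := by
          simpa using hpinv.const_mul (r : ℝ)
        simpa only [Function.comp_def, Real.sqrt_zero] using (Real.continuous_sqrt.tendsto 0).comp h2
      simpa using hN_lim.add h1
    have hint : ∀ m, ∫ f : MonicOfDegree (F m) (d m),
        |N m * (asN (F m) (p m) (L m) f.1 - q m ^ r / p m) -
          N m * r * (∑ i, X m i f - Fintype.card (S m) * (1 / p m))| ∂uniformMonic (F m) (d m) =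
        N m * ∫ f, |R m f| ∂uniformMonic (F m) (d m) := fun m => by
      rw [← integral_const_mul]
      exact integral_congr_ae (Eventually.of_forall (herr m))
    refine Tendsto.congr (fun m => (hint m).symm) ?_
    refine squeeze_zero' (Eventually.of_forall fun m =>
      mul_nonneg (hN0 m) (integral_nonneg fun f => abs_nonneg _)) ?_ hbound
    filter_upwards [hp_gt, hd_lim.eventually_ge_atTop (2 * r)] with m h1 h2
    have h3 := hR m h1 h2
    rw [hqcard] at h3
    refine (mul_le_mul_of_nonneg_left h3 (hN0 m)).trans ?_
    rw [mul_add, mul_one]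
    refine add_le_add_right ?_ _
    refine Real.le_sqrt_of_sq_le ?_
    have h4 : 0 < q m ^ (r - 1) := pow_pos (hq0 m) _
    have h5 : 0 < q m ^ r := pow_pos (hq0 m) _
    have h6 := hp0 m
    rw [mul_pow, hNsq, Real.sq_sqrt (by positivity)]
    -- The factor `p` of the squared normalisation cancels the `1 / p` of the variance, leaving the
    -- proportion of elements of small degree, which is `O(1 / p)`.
    have h7 : (p m : ℝ) / (r * q m ^ r) * (r * q m ^ (r - 1) * (r / p m)) =
        r * (q m ^ (r - 1) / q m ^ r) := by
      field_simp
    rw [h7]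
    exact mul_le_mul_of_nonneg_left (hsmall m) hr'.le
  · refine tendsto_integral_cexp_of_prod_eq (fun m => uniformMonic (F m) (d m)) X hX
      (θ := fun m => 1 / p m) (c := fun m => N m * r) (k := fun m => d m / r)
      (fun m => by have := hp0 m; positivity) (fun m => (div_le_one (hp0 m)).2 (hp1 m))
      ((Nat.tendsto_div_const_atTop hr.ne').comp hd_lim) ?_ ?_ ?_ t
    · filter_upwards [hp_gt] with m hm
      exact hprod m hm
    · simpa using hN_lim.mul_const (r : ℝ)
    -- The limit variance is the proportion of elements of `L` that have full degree `r`, times `1 -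
    -- 1 / p`; both tend to 1.
    · have hv : ∀ m, (N m * r) ^ 2 * (Fintype.card (S m) * (1 / p m * (1 - 1 / p m))) =
          (r * (S m).card / q m ^ r) * (1 - 1 / p m) := fun m => by
        have h5 : 0 < q m ^ r := pow_pos (hq0 m) _
        have h6 := hp0 m
        rw [mul_pow, hNsq, Fintype.card_coe]
        field_simp
      simp only [hv]
      have hfrac : Tendsto (fun m => (r * (S m).card / q m ^ r : ℝ)) atTop (nhds 1) := by
        have hlow : Tendsto (fun m => (1 - r * (1 / p m) : ℝ)) atTop (nhds 1) := by
          simpa using (hpinv.const_mul (r : ℝ)).const_sub 1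
        refine tendsto_of_tendsto_of_tendsto_of_le_of_le hlow tendsto_const_nhds
          (fun m => ?_) fun m => ?_
        · have h5 : 0 < q m ^ r := pow_pos (hq0 m) _
          have h7 : q m ^ r ≤ r * (S m).card + r * q m ^ (r - 1) := by
            rw [← hqcard]; exact_mod_cast hge m
          have h8 := mul_le_mul_of_nonneg_left (hsmall m) hr'.le
          have h9 : 1 ≤ (r * (S m).card / q m ^ r : ℝ) + r * (q m ^ (r - 1) / q m ^ r) := by
            rw [← mul_div_assoc, ← add_div, le_div_iff₀ h5, one_mul]
            exact h7
          simp only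
          linarith
        · have h5 : 0 < q m ^ r := pow_pos (hq0 m) _
          have h7 : (r * (S m).card : ℝ) ≤ q m ^ r := by
            rw [← hqcard]; exact_mod_cast hle m
          exact (div_le_one h5).2 h7
      simpa using hfrac.mul (hpinv.const_sub 1)
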